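/- **Setting.** Fix a kind of equation (nonlinear heat or nonlinear Black–Scholes), reals $\mu,\sigma$, $a\le b$ and a horizon $T>0$. For a dimension $d$, let $\eta$ be uniform on $[a,b]^d$ and $W$ an independent $d$-dimensional Brownian motion; the forward process is, for $1\le k\le d$, $$X_{t,k}=\eta_k+\mu t+\sigma W_{t,k}\ \text{ (heat)},\qquad X_{t,k}=\eta_k\exp\{(\mu-\sigma^2/2)t+\sigma W_{t,k}\}\ \text{ (Black–Scholes)}.$$ Let $f:[0,T]\times\mathbb R^d\times\mathbb R\times\mathbb R^d\to\mathbb R$ and $g:\mathbb R^d\to\mathbb R$ satisfy $$|f(t_1,x_1,y_1,z_1)-f(t_2,x_2,y_2,z_2)|\le C_f\big(|t_1-t_2|^{1/2}+\|x_1-x_2\|_2+|y_1-y_2|+\|z_1-z_2\|_2\big),\quad |g(x_1)-g(x_2)|\le C_g\|x_1-x_2\|_2$$ with $C_f,C_g\ge0$, and put $C_{fg}=\max\{C_f^2,C_g^2,f(0,0,0,0)^2,g(0)^2\}$. A network of structure $(l_1,\dots,l_{k+1})$, $k\ge1$, is $A_k\circ\tanh\circ A_{k-1}\circ\cdots\circ\tanh\circ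 A_1$ with affine maps $A_i:\mathbb R^{l_i}\to\mathbb R^{l_{i+1}}$, $\tanh$ acting componentwise; its parameter vector consists of all entries of the weight matrices and biases. Let $\mathcal S_1=(d,l_2,\dots,l_k,1)$ and $\mathcal S_2=(d,l_2,\dots,l_k,d)$, with depth $D(\mathcal S_1)=k$ and width $\|\mathcal S_1\|_\infty=\max\{d,l_2,\dots,l_k,1\}$. For $R\ge0$ let $\Theta$ be the set of joint parameters $\theta$ of a pair of networks $\mathcal U(\cdot;\theta)$ of structure $\mathcal S_1$ and $\mathcal Z(\cdot;\theta)$ of structure $\mathcal S_2$ with $\|\theta\|_\infty\le R$. Let $0=t_0<t_1<\dots<t_N=T$ and $0\le i\le N-1$. Let $\widehat{\mathcal U}_{i+1}=g$ if $i+1=N$, and otherwise let $\widehat{\mathcal U}_{i+1}$ be a (fixed) network of structure $\mathcal S_1$ with all parameters bounded by $R$ in absolute value. With $\Delta t_i=t_{i+1}-t_i$, $\Delta W_{t_i}=W_{t_{i+1}}-W_{t_i}$ put $$\mathcal L(\theta)=\mathbb E\Big|\widehat{\mathcal U}_{i+1}(X_{t_{i+1}})-\mathcal U(X_{t_i};\theta)+f\big(t_i,X_{t_i},\mathcal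 U(X_{t_i};\theta),\mathcal Z(X_{t_i};\theta)\big)\Delta t_i-\mathcal Z(X_{t_i};\theta)^\top\Delta W_{t_i}\Big|^2 .$$ Write $(\eta,W_{t_i},\Delta W_{t_i})=\big((b-a)\Phi(G_{1:d})+a,\ \sqrt{t_i}\,G_{(d+1):2d},\ \sqrt{\Delta t_i}\,G_{(2d+1):3d}\big)$ with $G$ standard Gaussian in $\mathbb R^{3d}$ and $\Phi$ the standard normal distribution function (componentwise), so that $\mathcal L(\theta)=\mathbb E[\mathcal G(G;\theta)]$, where $\mathcal G(\cdot;\theta)$ is the squared expression as a function of $G$. Let $\boldsymbol w_1,\dots,\boldsymbol w_m$ be i.i.d. standard Gaussian vectors in $\mathbb R^{3d}$ and $\mathcal L^{(m)}(\theta)=\frac1m\sum_{j=1}^m\mathcal G(\boldsymbol w_j;\theta)$. Let $\theta^*$ be a minimizer of $\mathcal L$ over $\Theta$, and let $\theta^{(m)}$ be a random element of $\Theta$ that almost surely minimizes $\mathcal L^{(m)}$ over $\Theta$. **Theorem.** There is a polynomial $p$ in four variables, depending only on the kind of equation and on $T,\mu,\sigma,a,b$, such that for all $d$, hidden widths $l_2,\dots,l_k$,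 $R$, $f$, $g$, $C_f$, $C_g$, time grids, $i$, $\widehat{\mathcal U}_{i+1}$, $\theta^*$ and $\theta^{(m)}$ as above and all $m\ge2$: $\mathcal G(G;\theta)$ is integrable for every $\theta\in\Theta$, $\mathcal L(\theta^{(m)})-\mathcal L(\theta^*)$ is integrable, and $$\mathbb E\big[\mathcal L(\theta^{(m)})-\mathcal L(\theta^*)\big]\le C\,m^{-1/2}\log m,\qquad C=p\big(R,\|\mathcal S_1\|_\infty,D(\mathcal S_1),C_{fg}\big).$$ -/

import Mathlib

open MeasureTheory ProbabilityTheory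

noncomputable section

/-! ### Feedforward tanh networks -/

/-- Index set of the parameters of an affine map `ℝⁿ → ℝᵖ`: entries of the weight matrix
(left summand) and of the bias (right summand). -/
abbrev AffineIdx (n p : ℕ) : Type := (Fin p × Fin n) ⊕ Fin p

/-- The affine map `x ↦ Q x + b` with parameters `θ = (Q, b)`. -/
def affineMap {n p : ℕ} (θ : AffineIdx n p → ℝ) (x : Fin n → ℝ) : Fin p → ℝ :=
  fun r => ∑ c, θ (Sum.inl (r, c)) * x c + θ (Sum.inr r)

/-- Index set of all the parameters of a network with input dimension `n`, list `hs` of hidden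
widths (in order) and output dimension `p`, i.e. of structure `(n, hs, p)`.
A parameter vector is a function `NetIdx n hs p → ℝ`; its norm is the maximum norm. -/
def NetIdx : ℕ → List ℕ → ℕ → Type
  | n, [], p => AffineIdx n p
  | n, h :: hs, p => AffineIdx n h ⊕ NetIdx h hs p

instance instFintypeNetIdx : (n : ℕ) → (hs : List ℕ) → (p : ℕ) → Fintype (NetIdx n hs p)
  | n, [], p => inferInstanceAs (Fintype (AffineIdx n p))
  | n, h :: hs, p =>
    letI := instFintypeNetIdx h hs p
    inferInstanceAs (Fintype (AffineIdx n h ⊕ NetIdx h hs p))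

/-- The network `x ↦ A_k (tanh (A_{k-1} ( ⋯ tanh (A_1 x))))` of structure `(n, hs, p)`;
`tanh` acts componentwise and there is none after the last affine map. -/
def net : {n : ℕ} → (hs : List ℕ) → {p : ℕ} → (NetIdx n hs p → ℝ) → (Fin n → ℝ) → (Fin p → ℝ)
  | _, [], _, θ, x => affineMap θ x
  | _, _ :: hs, _, θ, x =>
    net hs (fun j => θ (Sum.inr j)) (fun r => Real.tanh (affineMap (fun j => θ (Sum.inl j)) x r))

/-- Depth of the structure `(n, hs, p)`: the number of affine maps. -/
def netDepth (hs : List ℕ) : ℕ := hs.length + 1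

/-- Width of the structure `(n, hs, p)`: the largest of all layer sizes, input and output
included. -/
def netWidth (n : ℕ) (hs : List ℕ) (p : ℕ) : ℕ := (n :: p :: hs).foldr max 0

/-- Scalar network `𝒰(·; θ)` of structure `(d, hs, 1)` on `ℝᵈ`. -/
def scalarNet {d : ℕ} {hs : List ℕ} (θ : NetIdx d hs 1 → ℝ) (x : EuclideanSpace ℝ (Fin d)) : ℝ :=
  net hs θ x.ofLp 0

/-- Vector-valued network `𝒵(·; θ)` of structure `(d, hs, d)` on `ℝᵈ`. -/
def vectorNet {d : ℕ} {hs : List ℕ} (θ : NetIdx d hs d → ℝ) (x : EuclideanSpace ℝ (Fin d)) :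
    EuclideanSpace ℝ (Fin d) :=
  WithLp.toLp 2 (net hs θ x.ofLp)

/-- Joint parameters of the pair `(𝒰, 𝒵)`; the product norm is the maximum norm. -/
abbrev PairParam (d : ℕ) (hs : List ℕ) : Type := (NetIdx d hs 1 → ℝ) × (NetIdx d hs d → ℝ)

/-- The parameter space `Θ = {θ | ‖θ‖_∞ ≤ R}`. -/
def paramSpace (d : ℕ) (hs : List ℕ) (R : ℝ) : Set (PairParam d hs) := {θ | ‖θ‖ ≤ R}

/-! ### The forward process -/

/-- The two kinds of nonlinear equations. -/
inductive PDEKind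
  | heat
  | blackScholes

/-- The coefficients of the forward process (drift `μ`, volatility `σ`) and the interval `[a, b]`
such that the initial value is uniform on `[a, b]ᵈ`. -/
structure ForwardModel where
  kind : PDEKind
  μ : ℝ
  σ : ℝ
  a : ℝ
  b : ℝ

/-- Exact transition of the forward process over a time `h` with Brownian increment `ΔW`, from the
state `x`: componentwise `x + μ h + σ ΔW` for the heat equation (`dX = μ dt + σ dW`) and
`x exp ((μ - σ²/2) h + σ ΔW)` for Black-Scholes (`dX = μ X dt + σ X dW`). -/
def ForwardModel.transition (M : ForwardModel) {d : ℕ} (h : ℝ) (x ΔW : EuclideanSpace ℝ (Fin d)) :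
    EuclideanSpace ℝ (Fin d) :=
  match M.kind with
  | .heat => WithLp.toLp 2 fun k => x k + M.μ * h + M.σ * ΔW k
  | .blackScholes => WithLp.toLp 2 fun k => x k * Real.exp ((M.μ - M.σ ^ 2 / 2) * h + M.σ * ΔW k)

/-! ### Gaussian samples -/

/-- The space `ℝ³ᵈ` of samples, written as three blocks of length `d`. -/
abbrev NoiseSpace (d : ℕ) : Type := Fin 3 × Fin d → ℝ

/-- The standard Gaussian law on `ℝ³ᵈ`. -/
def gaussianNoise (d : ℕ) : Measure (NoiseSpace d) := Measure.pi fun _ => gaussianReal 0 1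

/-- The initial value `η = (b - a) Φ(W₁) + a` from the first block, `Φ` being the distribution
function of `N(0, 1)`; it is uniform on `[a, b]ᵈ`. -/
def ForwardModel.init (M : ForwardModel) {d : ℕ} (w : NoiseSpace d) : EuclideanSpace ℝ (Fin d) :=
  WithLp.toLp 2 fun k => (M.b - M.a) * cdf (gaussianReal 0 1) (w (0, k)) + M.a

/-- The Brownian motion at time `t`, from the second block. -/
def brownianAt {d : ℕ} (t : ℝ) (w : NoiseSpace d) : EuclideanSpace ℝ (Fin d) :=
  WithLp.toLp 2 fun k => √t * w (1, k)

/-- The Brownian increment over a time step `h`, from the third block. -/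
def brownianIncr {d : ℕ} (h : ℝ) (w : NoiseSpace d) : EuclideanSpace ℝ (Fin d) :=
  WithLp.toLp 2 fun k => √h * w (2, k)

/-- The forward process at time `t`. -/
def ForwardModel.stateAt (M : ForwardModel) {d : ℕ} (t : ℝ) (w : NoiseSpace d) :
    EuclideanSpace ℝ (Fin d) :=
  M.transition t (M.init w) (brownianAt t w)

/-- The forward process at time `t + h`. -/
def ForwardModel.stateNext (M : ForwardModel) {d : ℕ} (t h : ℝ) (w : NoiseSpace d) :
    EuclideanSpace ℝ (Fin d) :=
  M.transition h (M.stateAt t w) (brownianIncr h w)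

/-! ### The loss of deep backward dynamic programming -/

/-- `F(t, x, y, z, h, Δ) = y - f(t, x, y, z) h + zᵀ Δ`. -/
def dbdpF {d : ℕ}
    (f : ℝ → EuclideanSpace ℝ (Fin d) → ℝ → EuclideanSpace ℝ (Fin d) → ℝ)
    (t : ℝ) (x : EuclideanSpace ℝ (Fin d)) (y : ℝ) (z : EuclideanSpace ℝ (Fin d)) (h : ℝ)
    (Δ : EuclideanSpace ℝ (Fin d)) : ℝ :=
  y - f t x y z * h + inner ℝ z Δ

/-- Data of one backward step: the nonlinearity `f`, the current time `t`, the step size `h` and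
the approximation `Uhat` of the solution at time `t + h`. -/
structure BackwardStep (d : ℕ) where
  f : ℝ → EuclideanSpace ℝ (Fin d) → ℝ → EuclideanSpace ℝ (Fin d) → ℝ
  t : ℝ
  h : ℝ
  Uhat : EuclideanSpace ℝ (Fin d) → ℝ

/-- The squared residual `G(w; θ)` of the backward step for one sample `w`. -/
def sampleLoss {d : ℕ} {hs : List ℕ} (M : ForwardModel) (S : BackwardStep d)
    (w : NoiseSpace d) (θ : PairParam d hs) : ℝ :=
  |S.Uhat (M.stateNext S.t S.h w)
    - dbdpF S.f S.t (M.stateAt S.t w) (scalarNet θ.1 (M.stateAt S.t w))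
        (vectorNet θ.2 (M.stateAt S.t w)) S.h (brownianIncr S.h w)| ^ 2

/-- The risk `ℒ(θ) = 𝔼[G(W; θ)]`, `W` standard Gaussian in `ℝ³ᵈ`. -/
def risk {d : ℕ} {hs : List ℕ} (M : ForwardModel) (S : BackwardStep d) (θ : PairParam d hs) : ℝ :=
  ∫ w, sampleLoss M S w θ ∂gaussianNoise d

/-- The empirical risk of `m` samples. -/
def empiricalRisk {d : ℕ} {hs : List ℕ} {m : ℕ} (M : ForwardModel) (S : BackwardStep d)
    (w : Fin m → NoiseSpace d) (θ : PairParam d hs) : ℝ :=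
  (1 / (m : ℝ)) * ∑ j, sampleLoss M S (w j) θ

/-- `θ` is a minimizer of `J` over `A`. -/
def IsArgMin {α : Type*} (J : α → ℝ) (A : Set α) (θ : α) : Prop := θ ∈ A ∧ ∀ θ' ∈ A, J θ ≤ J θ'

/-! ### Lipschitz conditions -/

/-- The condition on the nonlinearity: `1/2`-Hölder in time on `[0, T]`, Lipschitz in the
remaining variables. -/
def LipschitzNonlinearity {d : ℕ} (T Cf : ℝ)
    (f : ℝ → EuclideanSpace ℝ (Fin d) → ℝ → EuclideanSpace ℝ (Fin d) → ℝ) : Prop :=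
  ∀ t₁ ∈ Set.Icc 0 T, ∀ t₂ ∈ Set.Icc 0 T, ∀ x₁ x₂ y₁ y₂ z₁ z₂,
    |f t₁ x₁ y₁ z₁ - f t₂ x₂ y₂ z₂| ≤ Cf * (√|t₁ - t₂| + ‖x₁ - x₂‖ + |y₁ - y₂| + ‖z₁ - z₂‖)

/-- The condition on the terminal function. -/
def LipschitzTerminal {d : ℕ} (Cg : ℝ) (g : EuclideanSpace ℝ (Fin d) → ℝ) : Prop :=
  ∀ x₁ x₂, |g x₁ - g x₂| ≤ Cg * ‖x₁ - x₂‖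

/-- `C_fg = max {C_f², C_g², f(0)², g(0)²}`. -/
def constFG {d : ℕ} (Cf Cg : ℝ)
    (f : ℝ → EuclideanSpace ℝ (Fin d) → ℝ → EuclideanSpace ℝ (Fin d) → ℝ)
    (g : EuclideanSpace ℝ (Fin d) → ℝ) : ℝ :=
  max (max (Cf ^ 2) (Cg ^ 2)) (max (f 0 0 0 0 ^ 2) (g 0 ^ 2))

end

/-! ### Empirical risk minimization for nonnegative losses -/

/-! The excess risk is controlled by a one-sided uniform deviation estimate. Since `θm` minimizes
the empirical risk, its excess risk is at most (risk minus empirical risk at `θm`) plus (empirical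
risk minus risk at `θstar`); the last bracket has mean zero. So only deviations of the empirical
mean below the mean matter. The loss is unbounded but nonnegative, and the lower tail of a
nonnegative variable is sub-Gaussian with variance proxy its second moment (`mgf_neg_le_of_nonneg`),
so no truncation is needed. Over a finite set of N parameters the expected maximal deviation is then
at most (log N + V/2)/√m, with V a bound for the second moments of the loss.

The parameter cube is replaced by a grid, at the cost of a random Lipschitz constant of the loss in
the parameters; `integral_excess_risk_le` combines the two errors. This Lipschitz constant is
exponential in the depth (`abs_net_sub_le`), but the mesh that compensates for it enters only
through log N, hence polynomially (`log_card_grid_le`). The size of a network does not grow with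
depth at all, because tanh is bounded (`abs_net_le`).

It remains to see that V is polynomial in the data. The residual is at most quadratic in the norms
of the states and of the Brownian increment, so V needs eighth moments of these. They are dominated
by a sum of exponentials of the Gaussian coordinates, whose eighth moment is polynomial in the
dimension (`exists_norm_state_le`, `exists_integral_noiseEnvelope_le`). -/

theorem exp_neg_le_quadratic {x : ℝ} (hx : 0 ≤ x) : Real.exp (-x) ≤ 1 - x + x ^ 2 / 2 := by
  have h := Real.quadratic_le_exp_of_nonneg hx
  have h1 : Real.exp (-x) * Real.exp x = 1 := by rw [← Real.exp_add]; simp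
  have h3 : 0 < Real.exp x := Real.exp_pos x
  have h4 : 0 ≤ 1 - x + x ^ 2 / 2 := by nlinarith [sq_nonneg (x - 1)]
  refine le_of_mul_le_mul_right ?_ h3
  rw [h1]
  -- (1 - x + x²/2)(1 + x + x²/2) = 1 + x⁴/4.
  nlinarith [mul_le_mul_of_nonneg_left h h4, sq_nonneg (x ^ 2)]

/-- The logarithm is below its tangent at `c`. -/
theorem log_le_tangent {s c : ℝ} (hs : 0 < s) (hc : 0 < c) :
    Real.log s ≤ Real.log c - 1 + s / c := by
  have h := Real.log_le_sub_one_of_pos (div_pos hs hc)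
  rw [Real.log_div hs.ne' hc.ne'] at h
  linarith

section ERM

variable {X : Type*} [MeasurableSpace X] {ν : Measure X}

theorem integrable_of_integrable_sq [IsProbabilityMeasure ν] {G : X → ℝ} (hG : Measurable G)
    (hG2 : Integrable (fun x => G x ^ 2) ν) : Integrable G ν :=
  ((memLp_two_iff_integrable_sq hG.aestronglyMeasurable).2 hG2).integrable (by norm_num)

theorem integrable_exp_neg_mul [IsProbabilityMeasure ν] {G : X → ℝ} (hG : Measurable G) (h0 : ∀ x, 0 ≤ G x) {s : ℝ}
    (hs : 0 ≤ s) : Integrable (fun x => Real.exp (-s * G x)) ν := by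
  refine Integrable.of_bound (C := 1) (by fun_prop) (ae_of_all _ fun x => ?_)
  rw [Real.norm_eq_abs, abs_of_pos (Real.exp_pos _), Real.exp_le_one_iff]
  nlinarith [mul_nonneg hs (h0 x)]

/-- The lower tail of a nonnegative random variable is sub-Gaussian. -/
theorem mgf_neg_le_of_nonneg [IsProbabilityMeasure ν] {G : X → ℝ} (hG : Measurable G) (h0 : ∀ x, 0 ≤ G x)
    (hG2 : Integrable (fun x => G x ^ 2) ν) {V : ℝ} (hV : ∫ x, G x ^ 2 ∂ν ≤ V) {s : ℝ}
    (hs : 0 ≤ s) :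
    mgf G ν (-s) ≤ Real.exp (-s * ∫ x, G x ∂ν + s ^ 2 * V / 2) := by
  have hGi := integrable_of_integrable_sq hG hG2
  have hlin : Integrable (fun x => 1 - s * G x) ν := (integrable_const _).sub (hGi.const_mul _)
  calc mgf G ν (-s) ≤ ∫ x, (1 - s * G x + s ^ 2 / 2 * G x ^ 2) ∂ν := by
        refine integral_mono (integrable_exp_neg_mul hG h0 hs)
          (hlin.add (hG2.const_mul _)) fun x => ?_
        have := exp_neg_le_quadratic (mul_nonneg hs (h0 x))
        simp only [neg_mul]
        nlinarith
    _ = 1 - s * ∫ x, G x ∂ν + s ^ 2 / 2 * ∫ x, G x ^ 2 ∂ν := by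
        rw [integral_add hlin (hG2.const_mul _), integral_sub (integrable_const _) (hGi.const_mul _), integral_const_mul,
          integral_const_mul]
        simp
    _ ≤ 1 + (-s * ∫ x, G x ∂ν + s ^ 2 * V / 2) := by
        nlinarith [mul_le_mul_of_nonneg_left hV (sq_nonneg s)]
    _ ≤ _ := by rw [add_comm]; exact Real.add_one_le_exp _

variable {Ω : Type*} [MeasurableSpace Ω] {P : Measure Ω}

theorem HasLaw.integrable_comp {Y : Ω → X} (hY : HasLaw Y ν P) {G : X → ℝ}
    (hG : Integrable G ν) : Integrable (fun ω => G (Y ω)) P :=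
  (hY.map_eq.symm ▸ hG : Integrable G (P.map Y)).comp_aemeasurable hY.aemeasurable

theorem HasLaw.integral_comp' {Y : Ω → X} (hY : HasLaw Y ν P) {G : X → ℝ}
    (hG : Integrable G ν) : ∫ ω, G (Y ω) ∂P = ∫ x, G x ∂ν :=
  hY.integral_comp hG.aestronglyMeasurable

theorem integral_sampleMean {m : ℕ} (hm : m ≠ 0) {w : Fin m → Ω → X}
    (hw : ∀ j, HasLaw (w j) ν P) {G : X → ℝ} (hG : Integrable G ν) :
    Integrable (fun ω => (1 / (m : ℝ)) * ∑ j, G (w j ω)) P ∧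
      ∫ ω, (1 / (m : ℝ)) * ∑ j, G (w j ω) ∂P = ∫ x, G x ∂ν := by
  have hi : ∀ j ∈ Finset.univ, Integrable (fun ω => G (w j ω)) P :=
    fun j _ => HasLaw.integrable_comp (hw j) hG
  refine ⟨(integrable_finsetSum _ hi).const_mul _, ?_⟩
  rw [integral_const_mul, integral_finsetSum _ hi,
    Finset.sum_congr rfl fun j _ => HasLaw.integral_comp' (hw j) hG]
  have : (m : ℝ) ≠ 0 := by exact_mod_cast hm
  simp [this]

/-- Exponential moment of the deviation of the empirical mean below the mean. -/
theorem exp_deviation_le [IsProbabilityMeasure ν] [IsProbabilityMeasure P] {m : ℕ} (hm : m ≠ 0)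
    {w : Fin m → Ω → X}
    (hw : ∀ j, HasLaw (w j) ν P) (hind : iIndepFun w P) {G : X → ℝ} (hG : Measurable G)
    (h0 : ∀ x, 0 ≤ G x) (hG2 : Integrable (fun x => G x ^ 2) ν) {V : ℝ}
    (hV : ∫ x, G x ^ 2 ∂ν ≤ V) :
    Integrable (fun ω => Real.exp (√m * (∫ x, G x ∂ν - (1 / (m : ℝ)) * ∑ j, G (w j ω)))) P ∧
      ∫ ω, Real.exp (√m * (∫ x, G x ∂ν - (1 / (m : ℝ)) * ∑ j, G (w j ω))) ∂P
        ≤ Real.exp (V / 2) := by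
  have hm' : (0 : ℝ) < m := by exact_mod_cast Nat.pos_of_ne_zero hm
  set L := ∫ x, G x ∂ν with hL
  -- s = 1/√m is the scale at which m factors of the moment generating function, each contributing
  -- s²V/2 to the exponent, give V/2 in total.
  set s : ℝ := √m / m with hs
  have hs0 : 0 ≤ s := by positivity
  have hms : m * s = √m := by rw [hs]; field_simp
  have hms2 : m * s ^ 2 = 1 := by
    rw [hs, div_pow, Real.sq_sqrt hm'.le]; field_simp
  have hfun : (fun ω => Real.exp (√m * (L - (1 / (m : ℝ)) * ∑ j, G (w j ω)))) =
      fun ω => Real.exp (√m * L) * Real.exp (-s * (∑ j, fun ω => G (w j ω)) ω) := by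
    funext ω
    rw [← Real.exp_add, Finset.sum_apply]
    congr 1
    rw [hs]; ring
  have hmeas : ∀ j, AEMeasurable (fun ω => G (w j ω)) P :=
    fun j => hG.comp_aemeasurable (hw j).aemeasurable
  have hindG : iIndepFun (fun j ω => G (w j ω)) P := hind.comp (fun _ => G) fun _ => hG
  have hmgf : ∀ j, mgf (fun ω => G (w j ω)) P (-s) = mgf G ν (-s) := fun j =>
    HasLaw.integral_comp' (hw j) (integrable_exp_neg_mul hG h0 hs0)
  rw [hfun]
  constructor
  · refine Integrable.const_mul (Integrable.of_bound (C := 1) ?_ (ae_of_all _ fun ω => ?_)) _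
    · refine AEMeasurable.aestronglyMeasurable ?_
      simp only [Finset.sum_apply]
      fun_prop
    · rw [Real.norm_eq_abs, abs_of_pos (Real.exp_pos _), Real.exp_le_one_iff, Finset.sum_apply]
      have : 0 ≤ ∑ j, G (w j ω) := Finset.sum_nonneg fun j _ => h0 _
      nlinarith [mul_nonneg hs0 this]
  · rw [integral_const_mul]
    have h1 : ∫ ω, Real.exp (-s * (∑ j, fun ω => G (w j ω)) ω) ∂P = mgf G ν (-s) ^ m := by
      have := hindG.mgf_sum₀ (t := -s) hmeas Finset.univ
      rw [Finset.prod_congr rfl fun j _ => hmgf j] at this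
      simpa [mgf] using this
    rw [h1]
    calc Real.exp (√m * L) * mgf G ν (-s) ^ m
        ≤ Real.exp (√m * L) * Real.exp (-s * L + s ^ 2 * V / 2) ^ m := by
          gcongr
          · exact mgf_nonneg
          · exact mgf_neg_le_of_nonneg hG h0 hG2 hV hs0
      _ = Real.exp (V / 2) := by
          rw [← Real.exp_nat_mul, ← Real.exp_add]
          congr 1
          linear_combination (-L) * hms + V / 2 * hms2

/-- Expected excess risk of an empirical risk minimizer for a nonnegative loss with uniformly
bounded second moments over a parameter set `A`, in terms of a finite `Λ`-approximation of `A`. -/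
theorem integral_excess_risk_le [IsProbabilityMeasure ν] [IsProbabilityMeasure P]
    {Θ κ : Type*} [Fintype κ] [Nonempty κ]
    {ℓ : X → Θ → ℝ} {A : Set Θ} (hmeas : ∀ θ ∈ A, Measurable fun x => ℓ x θ)
    (h0 : ∀ x θ, 0 ≤ ℓ x θ) (h2 : ∀ θ ∈ A, Integrable (fun x => ℓ x θ ^ 2) ν) {V : ℝ}
    (hV : ∀ θ ∈ A, ∫ x, ℓ x θ ^ 2 ∂ν ≤ V) {Λ : X → ℝ} (hΛ : Integrable Λ ν) {pt : κ → Θ}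
    (hpt : ∀ k, pt k ∈ A) (hcover : ∀ θ ∈ A, ∃ k, ∀ x, |ℓ x θ - ℓ x (pt k)| ≤ Λ x)
    {θstar : Θ} (hstar : θstar ∈ A) {m : ℕ} (hm : m ≠ 0) {w : Fin m → Ω → X}
    (hw : ∀ j, HasLaw (w j) ν P) (hind : iIndepFun w P) {θm : Ω → Θ}
    (hmin : ∀ᵐ ω ∂P, IsArgMin (fun θ => (1 / (m : ℝ)) * ∑ j, ℓ (w j ω) θ) A (θm ω))
    (hint : Integrable (fun ω => ∫ x, ℓ x (θm ω) ∂ν - ∫ x, ℓ x θstar ∂ν) P) :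
    ∫ ω, (∫ x, ℓ x (θm ω) ∂ν - ∫ x, ℓ x θstar ∂ν) ∂P ≤
      (Real.log (Fintype.card κ) + V / 2) / √m + 2 * ∫ x, Λ x ∂ν := by
  have hm' : (0 : ℝ) < m := by exact_mod_cast Nat.pos_of_ne_zero hm
  have hsm : 0 < √(m : ℝ) := Real.sqrt_pos.2 hm'
  have hi : ∀ θ ∈ A, Integrable (fun x => ℓ x θ) ν :=
    fun θ hθ => integrable_of_integrable_sq (hmeas θ hθ) (h2 θ hθ)
  set L : Θ → ℝ := fun θ => ∫ x, ℓ x θ ∂ν with hL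
  set Lm : Ω → Θ → ℝ := fun ω θ => (1 / (m : ℝ)) * ∑ j, ℓ (w j ω) θ with hLm
  set E : κ → Ω → ℝ := fun k ω => Real.exp (√m * (L (pt k) - Lm ω (pt k))) with hE
  have hdev : ∀ k, Integrable (E k) P ∧ ∫ ω, E k ω ∂P ≤ Real.exp (V / 2) := fun k =>
    exp_deviation_le hm hw hind (hmeas _ (hpt k)) (fun x => h0 x _) (h2 _ (hpt k)) (hV _ (hpt k))
  -- c bounds the mean of the sum of the E k. Taking the tangent of log at c gives a pointwise
  -- substitute for Jensen's inequality.
  set c : ℝ := Fintype.card κ * Real.exp (V / 2) with hc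
  have hcard : (0 : ℝ) < Fintype.card κ := by exact_mod_cast Fintype.card_pos
  have hc0 : 0 < c := by positivity
  have hlogc : Real.log c = Real.log (Fintype.card κ) + V / 2 := by
    rw [hc, Real.log_mul hcard.ne' (Real.exp_pos _).ne', Real.log_exp]
  set mΛ : Ω → ℝ := fun ω => (1 / (m : ℝ)) * ∑ j, Λ (w j ω) with hmΛ
  obtain ⟨hmΛi, hmΛe⟩ := integral_sampleMean hm hw hΛ
  obtain ⟨hsi, hse⟩ := integral_sampleMean hm hw (hi _ hstar)
  have hEi : Integrable (fun ω => ∑ k, E k ω) P := integrable_finsetSum _ fun k _ => (hdev k).1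
  have hEe : ∫ ω, ∑ k, E k ω ∂P ≤ c := by
    rw [integral_finsetSum _ fun k _ => (hdev k).1]
    refine (Finset.sum_le_card_nsmul _ _ _ fun k _ => (hdev k).2).trans ?_
    simp [hc]
  -- Pass from `θm ω` to a nearby `pt k` and back, in the risk and in the empirical risk. The index
  -- k depends on ω but does not occur in the bound, so no measurable choice of it is needed.
  have hpoint : ∀ᵐ ω ∂P, L (θm ω) - L θstar ≤
      ((Real.log c - 1) / √m + 1 / (c * √m) * ∑ k, E k ω) +
        ((∫ x, Λ x ∂ν) + mΛ ω) + (Lm ω θstar - L θstar) := by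
    filter_upwards [hmin] with ω hω
    obtain ⟨hA, hle⟩ := hω
    obtain ⟨k, hk⟩ := hcover _ hA
    have h1 : L (θm ω) - L (pt k) ≤ ∫ x, Λ x ∂ν := by
      rw [hL]
      simp only
      rw [← integral_sub (hi _ hA) (hi _ (hpt k))]
      exact integral_mono ((hi _ hA).sub (hi _ (hpt k))) hΛ fun x => (le_abs_self _).trans (hk x)
    have h2' : Lm ω (pt k) - Lm ω (θm ω) ≤ mΛ ω := by
      simp only [hLm, hmΛ]
      rw [← mul_sub, ← Finset.sum_sub_distrib]
      gcongr with j
      rw [← neg_sub]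
      exact (neg_le_abs _).trans (hk _)
    have h3 : Lm ω (θm ω) ≤ Lm ω θstar := hle _ hstar
    have h4 : √m * (L (pt k) - Lm ω (pt k)) ≤ Real.log c - 1 + (∑ k, E k ω) / c := by
      have hEk : E k ω ≤ ∑ k, E k ω :=
        Finset.single_le_sum (f := fun k => E k ω) (fun _ _ => (Real.exp_pos _).le)
          (Finset.mem_univ k)
      have hpos : 0 < E k ω := Real.exp_pos _
      calc √m * (L (pt k) - Lm ω (pt k)) = Real.log (E k ω) := (Real.log_exp _).symm
        _ ≤ Real.log (∑ k, E k ω) := Real.log_le_log hpos hEk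
        _ ≤ _ := log_le_tangent (hpos.trans_le hEk) hc0
    have h5 : L (pt k) - Lm ω (pt k) ≤
        (Real.log c - 1) / √m + 1 / (c * √m) * ∑ k, E k ω := by
      rw [← mul_le_mul_iff_right₀ hsm]
      refine h4.trans_eq ?_
      field_simp
    linarith
  have hI1 : Integrable
      (fun ω => (Real.log c - 1) / √m + 1 / (c * √m) * ∑ k, E k ω) P :=
    (integrable_const _).add (hEi.const_mul _)
  have hI2 : Integrable (fun ω => (∫ x, Λ x ∂ν) + mΛ ω) P := (integrable_const _).add hmΛi
  have hI3 : Integrable (fun ω => Lm ω θstar - L θstar) P := hsi.sub (integrable_const _)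
  refine (integral_mono_ae hint ((hI1.add hI2).add hI3) hpoint).trans ?_
  rw [integral_add' (hI1.add hI2) hI3, integral_add' hI1 hI2,
    integral_add (integrable_const _) (hEi.const_mul _), integral_const_mul,
    integral_add (integrable_const _) hmΛi, integral_sub hsi (integrable_const _), hmΛe, hse]
  simp only [integral_const, probReal_univ, smul_eq_mul, one_mul]
  -- In the mean, the linear term of the tangent cancels its constant -1.
  have h6 : 1 / (c * √m) * ∫ ω, ∑ k, E k ω ∂P ≤ 1 / √m := by
    calc 1 / (c * √m) * ∫ ω, ∑ k, E k ω ∂P ≤ 1 / (c * √m) * c := by gcongr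
      _ = 1 / √m := by field_simp
  have h7 : (Real.log c - 1) / √m + 1 / √m =
      (Real.log (Fintype.card κ) + V / 2) / √m := by rw [hlogc]; ring
  linarith

end ERM

/-! ### Bounds for tanh networks -/

theorem hasDerivAt_tanh (x : ℝ) : HasDerivAt Real.tanh (1 / Real.cosh x ^ 2) x := by
  have h : Real.tanh = fun y => Real.sinh y / Real.cosh y := by
    funext y; exact Real.tanh_eq_sinh_div_cosh y
  rw [h]
  have := (Real.hasDerivAt_sinh x).div (Real.hasDerivAt_cosh x) (Real.cosh_pos x).ne'
  rwa [← pow_two, ← pow_two, Real.cosh_sq_sub_sinh_sq] at this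

theorem abs_tanh_sub_tanh_le (x y : ℝ) : |Real.tanh x - Real.tanh y| ≤ |x - y| := by
  have h : LipschitzWith 1 Real.tanh := by
    refine lipschitzWith_of_nnnorm_deriv_le (fun x => (hasDerivAt_tanh x).differentiableAt)
      fun x => ?_
    rw [(hasDerivAt_tanh x).deriv, ← NNReal.coe_le_coe, coe_nnnorm, Real.norm_eq_abs,
      abs_of_nonneg (by positivity), NNReal.coe_one]
    exact div_le_one_of_le₀ (one_le_pow₀ (Real.one_le_cosh x)) (by positivity)
  simpa [Real.dist_eq] using h.dist_le_mul x y

theorem continuous_tanh : Continuous Real.tanh :=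
  continuous_iff_continuousAt.2 fun x => (hasDerivAt_tanh x).continuousAt

/-- The bias acts as the weight of one more input equal to 1 ≤ B, which is why v has to dominate n +
1. -/
theorem abs_affineMap_le {n p : ℕ} {θ : AffineIdx n p → ℝ} {x : Fin n → ℝ} {ρ v B : ℝ}
    (hρ : 0 ≤ ρ) (hB : 1 ≤ B) (hn : (n : ℝ) + 1 ≤ v) (hθ : ∀ i, |θ i| ≤ ρ)
    (hx : ∀ c, |x c| ≤ B) (r : Fin p) : |affineMap θ x r| ≤ ρ * v * B := by
  calc |affineMap θ x r| ≤ ∑ c, |θ (Sum.inl (r, c)) * x c| + |θ (Sum.inr r)| :=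
        (abs_add_le _ _).trans (by gcongr; exact Finset.abs_sum_le_sum_abs _ _)
    _ ≤ ∑ _c : Fin n, ρ * B + ρ * B := by
        gcongr with c
        · rw [abs_mul]; exact mul_le_mul (hθ _) (hx c) (abs_nonneg _) hρ
        · exact (hθ _).trans (le_mul_of_one_le_right hρ hB)
    _ = ρ * (n + 1) * B := by simp; ring
    _ ≤ ρ * v * B := by gcongr

/-- The difference splits into (θ - θ') applied to x and the weights of θ' applied to x - x'; the
bias only enters the first part. -/
theorem abs_affineMap_sub_le {n p : ℕ} {θ θ' : AffineIdx n p → ℝ} {x x' : Fin n → ℝ}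
    {ρ v B δ e : ℝ} (hρ : 0 ≤ ρ) (hB : 1 ≤ B) (hδ : 0 ≤ δ) (he : 0 ≤ e) (hn : (n : ℝ) + 1 ≤ v)
    (hθ' : ∀ i, |θ' i| ≤ ρ) (hθ : ∀ i, |θ i - θ' i| ≤ δ) (hx : ∀ c, |x c| ≤ B)
    (hxx : ∀ c, |x c - x' c| ≤ e) (r : Fin p) :
    |affineMap θ x r - affineMap θ' x' r| ≤ δ * v * B + ρ * v * e := by
  have h : affineMap θ x r - affineMap θ' x' r = affineMap (fun i => θ i - θ' i) x r +
      ∑ c, θ' (Sum.inl (r, c)) * (x c - x' c) := by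
    simp only [affineMap, sub_mul, mul_sub, Finset.sum_sub_distrib]
    ring
  rw [h]
  refine (abs_add_le _ _).trans (add_le_add (abs_affineMap_le hδ hB hn hθ hx r) ?_)
  calc |∑ c, θ' (Sum.inl (r, c)) * (x c - x' c)|
      ≤ ∑ c, |θ' (Sum.inl (r, c)) * (x c - x' c)| := Finset.abs_sum_le_sum_abs _ _
    _ ≤ ∑ _c : Fin n, ρ * e := by
        gcongr with c
        rw [abs_mul]; exact mul_le_mul (hθ' _) (hxx c) (abs_nonneg _) hρ
    _ = ρ * n * e := by simp; ring
    _ ≤ ρ * v * e := by gcongr; linarith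

/-- Every tanh layer brings the values back to [-1, 1], so only the last affine map counts and depth
does not appear. -/
theorem abs_net_le {ρ v B : ℝ} (hρ : 0 ≤ ρ) (hB : 1 ≤ B) (hs : List ℕ) {n p : ℕ}
    {θ : NetIdx n hs p → ℝ} {x : Fin n → ℝ} (hn : (n : ℝ) + 1 ≤ v)
    (hhs : ∀ h ∈ hs, (h : ℝ) + 1 ≤ v) (hθ : ∀ i, |θ i| ≤ ρ) (hx : ∀ c, |x c| ≤ B) (r : Fin p) :
    |net hs θ x r| ≤ ρ * v * B := by
  induction hs generalizing n with
  | nil => exact abs_affineMap_le hρ hB hn hθ hx r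
  | cons h hs ih =>
    exact ih (hhs h (by simp)) (fun k hk => hhs k (by simp [hk])) (fun i => hθ (Sum.inr i))
      fun c => (Real.abs_tanh_lt_one _).le.trans hB

/-- Networks are Lipschitz in their parameters and their input. -/
theorem abs_net_sub_le {ρ v B δ : ℝ} (hρ : 1 ≤ ρ) (hB : 1 ≤ B) (hδ : 0 ≤ δ) (hs : List ℕ)
    {n p : ℕ} {θ θ' : NetIdx n hs p → ℝ} {x x' : Fin n → ℝ} (hn : (n : ℝ) + 1 ≤ v)
    (hhs : ∀ h ∈ hs, (h : ℝ) + 1 ≤ v) (hθ' : ∀ i, |θ' i| ≤ ρ) (hθ : ∀ i, |θ i - θ' i| ≤ δ)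
    (hx : ∀ c, |x c| ≤ B) {e : ℝ} (he : 1 ≤ e) (hxx : ∀ c, |x c - x' c| ≤ δ * B * e)
    (r : Fin p) :
    |net hs θ x r - net hs θ' x' r| ≤ δ * B * (e * (2 * ρ * v) ^ (hs.length + 1)) := by
  -- The number e measures the input discrepancy in units of δB, and each layer multiplies it by
  -- 2ρv: one ρv propagates the old discrepancy, the other absorbs the new parameter error since ρe
  -- ≥ 1. This is why e ≥ 1 is kept even when the inputs coincide.
  have hlayer : ∀ {n q : ℕ} {θ θ' : AffineIdx n q → ℝ} {x x' : Fin n → ℝ}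
      (_ : (n : ℝ) + 1 ≤ v) (_ : ∀ i, |θ' i| ≤ ρ) (_ : ∀ i, |θ i - θ' i| ≤ δ)
      (_ : ∀ c, |x c| ≤ B) {e : ℝ} (_ : 1 ≤ e) (_ : ∀ c, |x c - x' c| ≤ δ * B * e) (r : Fin q),
      |affineMap θ x r - affineMap θ' x' r| ≤ δ * B * (e * (2 * ρ * v)) := by
    intro n q θ θ' x x' hn hθ' hθ hx e he hxx r
    have hv : 0 ≤ v := le_trans (by positivity) hn
    refine (abs_affineMap_sub_le (by linarith) hB hδ (by positivity) hn hθ' hθ hx hxx r).trans ?_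
    have h1 : 1 ≤ ρ * e := one_le_mul_of_one_le_of_one_le hρ he
    have h2 : 0 ≤ δ * v * B := by positivity
    nlinarith [mul_le_mul_of_nonneg_left h1 h2]
  induction hs generalizing n e with
  | nil =>
    simp only [List.length_nil, zero_add, pow_one]
    exact hlayer hn hθ' hθ hx he hxx r
  | cons h hs ih =>
    have hv : 1 ≤ v := le_trans (by simp) hn
    have h2 : 1 ≤ 2 * ρ * v := by nlinarith
    have := ih (θ := fun j => θ (Sum.inr j)) (θ' := fun j => θ' (Sum.inr j))
      (x := fun r => Real.tanh (affineMap (fun j => θ (Sum.inl j)) x r))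
      (x' := fun r => Real.tanh (affineMap (fun j => θ' (Sum.inl j)) x' r))
      (hhs h (by simp)) (fun k hk => hhs k (by simp [hk]))
      (fun i => hθ' (Sum.inr i)) (fun i => hθ (Sum.inr i))
      (fun c => (Real.abs_tanh_lt_one _).le.trans hB)
      (e := e * (2 * ρ * v)) (one_le_mul_of_one_le_of_one_le he h2)
      (fun c => (abs_tanh_sub_tanh_le _ _).trans
        (hlayer hn (fun i => hθ' (Sum.inl i)) (fun i => hθ (Sum.inl i)) hx he hxx c))
    refine this.trans_eq ?_
    rw [List.length_cons, pow_succ (2 * ρ * v) (hs.length + 1)]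
    ring

theorem continuous_net (hs : List ℕ) {n p : ℕ} (θ : NetIdx n hs p → ℝ) :
    Continuous (net hs θ : (Fin n → ℝ) → (Fin p → ℝ)) := by
  induction hs generalizing n with
  | nil =>
    change Continuous (affineMap θ)
    unfold affineMap
    fun_prop
  | cons h hs ih =>
    refine (ih fun j => θ (Sum.inr j)).comp (continuous_pi fun r => continuous_tanh.comp ?_)
    unfold affineMap
    fun_prop

theorem card_netIdx_le {v : ℝ} (hs : List ℕ) {n p : ℕ} (hn : (n : ℝ) + 1 ≤ v)
    (hhs : ∀ h ∈ hs, (h : ℝ) + 1 ≤ v) (hp : (p : ℝ) + 1 ≤ v) :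
    (Fintype.card (NetIdx n hs p) : ℝ) ≤ (hs.length + 1) * v ^ 2 := by
  have haff : ∀ {n p : ℕ} (_ : (n : ℝ) + 1 ≤ v) (_ : (p : ℝ) + 1 ≤ v),
      (Fintype.card (AffineIdx n p) : ℝ) ≤ v ^ 2 := by
    intro n p hn hp
    have : (Fintype.card (AffineIdx n p) : ℝ) = p * (n + 1) := by simp; ring
    rw [this]
    have hn0 : (0 : ℝ) ≤ n := n.cast_nonneg
    have hp0 : (0 : ℝ) ≤ p := p.cast_nonneg
    nlinarith
  induction hs generalizing n with
  | nil =>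
    simp only [List.length_nil, Nat.cast_zero, zero_add, one_mul]
    exact haff hn hp
  | cons h hs ih =>
    have h1 : Fintype.card (NetIdx n (h :: hs) p) =
        Fintype.card (AffineIdx n h) + Fintype.card (NetIdx h hs p) :=
      Fintype.card_sum (α := AffineIdx n h) (β := NetIdx h hs p)
    rw [h1]
    push_cast
    have h2 := haff hn (hhs h (by simp))
    have h3 := ih (hhs h (by simp)) (fun k hk => hhs k (by simp [hk]))
    simp only [List.length_cons]
    push_cast
    linarith

theorem le_foldr_max {l : List ℕ} {h : ℕ} (hh : h ∈ l) : h ≤ l.foldr max 0 := by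
  induction l with
  | nil => simp at hh
  | cons a l ih =>
    rcases List.mem_cons.1 hh with rfl | hl
    · exact le_max_left _ _
    · exact (ih hl).trans (le_max_right _ _)

/-! ### Finite grids in the parameter cube. -/

/-- Every point of `[-R, R]` is within `2R/n` of a grid point. -/
theorem exists_grid_point {R : ℝ} {n : ℕ} (hn : n ≠ 0) {x : ℝ} (hx : |x| ≤ R) :
    ∃ k : Fin (n + 1), |x - (-R + 2 * R * k / n)| ≤ 2 * R / n := by
  have hn' : (0 : ℝ) < n := by exact_mod_cast Nat.pos_of_ne_zero hn
  obtain ⟨h1, h2⟩ := abs_le.1 hx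
  rcases (show (0 : ℝ) ≤ R from (abs_nonneg x).trans hx).eq_or_lt with rfl | hR
  · exact ⟨0, by simp [le_antisymm h2 (by linarith)]⟩
  -- The position of x in units of the mesh. Its floor equals n at x = R, hence n + 1 nodes.
  set y : ℝ := (x + R) / (2 * R) * n with hy
  have hy0 : 0 ≤ y := by
    have : 0 ≤ x + R := by linarith
    positivity
  have hyn : y ≤ n := by
    have : (x + R) / (2 * R) ≤ 1 := by rw [div_le_one (by positivity)]; linarith
    nlinarith
  have hfl : ⌊y⌋₊ < n + 1 := by
    have : ⌊y⌋₊ ≤ n := Nat.floor_le_of_le hyn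
    omega
  refine ⟨⟨⌊y⌋₊, hfl⟩, ?_⟩
  have e : x - (-R + 2 * R * (⌊y⌋₊ : ℝ) / n) = 2 * R / n * (y - ⌊y⌋₊) := by
    rw [hy]; field_simp; ring
  have h3 := Nat.floor_le hy0
  have h4 := Nat.lt_floor_add_one y
  simp only
  rw [e, abs_mul, abs_of_pos (by positivity : (0 : ℝ) < 2 * R / n)]
  refine mul_le_of_le_one_right (by positivity) ?_
  rw [abs_le]; constructor <;> linarith

theorem abs_grid_point_le {R : ℝ} (hR : 0 ≤ R) {n : ℕ} (k : Fin (n + 1)) :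
    |(-R + 2 * R * k / n : ℝ)| ≤ R := by
  have h1 : (k : ℝ) / n ≤ 1 := div_le_one_of_le₀ (by exact_mod_cast k.is_le) (by positivity)
  have h2 : 0 ≤ (k : ℝ) / n := by positivity
  rw [mul_div_assoc, abs_le]
  constructor <;> nlinarith

/-- The grid of mesh `2R/n` in the parameter space. -/
noncomputable def paramGrid {d : ℕ} {hs : List ℕ} (R : ℝ) (n : ℕ)
    (k : NetIdx d hs 1 ⊕ NetIdx d hs d → Fin (n + 1)) : PairParam d hs :=
  (fun i => -R + 2 * R * (k (Sum.inl i) : ℕ) / n, fun i => -R + 2 * R * (k (Sum.inr i) : ℕ) / n)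

theorem mem_paramSpace {d : ℕ} {hs : List ℕ} {R : ℝ} (hR : 0 ≤ R) {θ : PairParam d hs} :
    θ ∈ paramSpace d hs R ↔ (∀ i, |θ.1 i| ≤ R) ∧ ∀ i, |θ.2 i| ≤ R := by
  simp only [paramSpace, Set.mem_ofPred_eq, Prod.norm_def, max_le_iff, pi_norm_le_iff_of_nonneg hR,
    Real.norm_eq_abs]

theorem paramGrid_mem {d : ℕ} {hs : List ℕ} {R : ℝ} (hR : 0 ≤ R) {n : ℕ}
    (k : NetIdx d hs 1 ⊕ NetIdx d hs d → Fin (n + 1)) :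
    paramGrid R n k ∈ paramSpace d hs R :=
  (mem_paramSpace hR).2 ⟨fun _ => abs_grid_point_le hR _, fun _ => abs_grid_point_le hR _⟩

theorem exists_paramGrid_near {d : ℕ} {hs : List ℕ} {R : ℝ} (hR : 0 ≤ R) {n : ℕ} (hn : n ≠ 0)
    {θ : PairParam d hs} (hθ : θ ∈ paramSpace d hs R) :
    ∃ k, ‖θ - paramGrid R n k‖ ≤ 2 * R / n := by
  obtain ⟨h1, h2⟩ := (mem_paramSpace hR).1 hθ
  choose k₁ hk₁ using fun i => exists_grid_point hn (h1 i)
  choose k₂ hk₂ using fun i => exists_grid_point hn (h2 i)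
  exact ⟨Sum.elim k₁ k₂, (mem_paramSpace (by positivity)).2 ⟨hk₁, hk₂⟩⟩

/-! ### Moments of the forward process -/

/-- A bound, up to a constant factor, for all the random quantities in the loss. -/
noncomputable def noiseEnvelope {d : ℕ} (c : ℝ) (w : NoiseSpace d) : ℝ :=
  1 + ∑ i, Real.exp (c * |w i|)

theorem one_le_noiseEnvelope {d : ℕ} (c : ℝ) (w : NoiseSpace d) : 1 ≤ noiseEnvelope c w :=
  le_add_of_nonneg_right (Finset.sum_nonneg fun _ _ => (Real.exp_pos _).le)

theorem measurable_noiseEnvelope {d : ℕ} (c : ℝ) :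
    Measurable (noiseEnvelope c : NoiseSpace d → ℝ) := by
  unfold noiseEnvelope
  fun_prop

instance isProbabilityMeasure_gaussianNoise (d : ℕ) : IsProbabilityMeasure (gaussianNoise d) := by
  unfold gaussianNoise; infer_instance

theorem integrable_exp_mul_abs_gaussianReal (c : ℝ) :
    Integrable (fun x => Real.exp (c * |x|)) (gaussianReal 0 1) :=
  integrable_exp_mul_abs (X := id) (integrable_exp_mul_gaussianReal c)
    (integrable_exp_mul_gaussianReal (-c))

/-- Two power-mean inequalities reduce the eighth power to the sum of the exp(8c|w i|), with a
factor (3d)⁷; the one-dimensional Gaussian integral does not depend on d. The exponent is 8 because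
the residual is quadratic in the state, the loss quartic, and its square is integrated. -/
theorem exists_integral_noiseEnvelope_le (c : ℝ) : ∃ C : ℝ, 0 ≤ C ∧ ∀ d : ℕ,
    Integrable (fun w : NoiseSpace d => noiseEnvelope c w ^ 8) (gaussianNoise d) ∧
      ∫ w : NoiseSpace d, noiseEnvelope c w ^ 8 ∂gaussianNoise d ≤ C * ((d : ℝ) + 1) ^ 8 := by
  set κ : ℝ := ∫ x, Real.exp (8 * c * |x|) ∂gaussianReal 0 1 with hκ
  have hκ0 : 0 ≤ κ := integral_nonneg fun x => (Real.exp_pos _).le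
  refine ⟨2 ^ 7 * 3 ^ 8 * (1 + κ), by positivity, fun d => ?_⟩
  have hi : ∀ i : Fin 3 × Fin d,
      Integrable (fun w : NoiseSpace d => Real.exp (8 * c * |w i|)) (gaussianNoise d) := fun i =>
    integrable_comp_eval (μ := fun _ : Fin 3 × Fin d => gaussianReal 0 1) (i := i)
      (integrable_exp_mul_abs_gaussianReal (8 * c))
  have he : ∀ i : Fin 3 × Fin d,
      ∫ w : NoiseSpace d, Real.exp (8 * c * |w i|) ∂gaussianNoise d = κ := fun i =>
    integral_comp_eval (μ := fun _ : Fin 3 × Fin d => gaussianReal 0 1) (i := i)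
      (integrable_exp_mul_abs_gaussianReal (8 * c)).aestronglyMeasurable
  have hb : ∀ w : NoiseSpace d, noiseEnvelope c w ^ 8 ≤
      2 ^ 7 * (1 + (3 * d : ℝ) ^ 7 * ∑ i, Real.exp (8 * c * |w i|)) := by
    intro w
    have h1 := add_pow_le (zero_le_one (α := ℝ))
      (Finset.sum_nonneg fun i _ => (Real.exp_pos (c * |w i|)).le : 0 ≤ ∑ i, Real.exp (c * |w i|)) 8
    refine h1.trans ?_
    norm_num only [one_pow]
    gcongr
    have h2 := pow_sum_le_card_mul_sum_pow (s := Finset.univ) (f := fun i => Real.exp (c * |w i|))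
      (fun i _ => (Real.exp_pos _).le) 7
    refine h2.trans_eq ?_
    simp only [Finset.card_univ, Fintype.card_prod, Fintype.card_fin, ← Real.exp_nat_mul]
    push_cast
    simp only [mul_assoc]
  have hI : Integrable (fun w : NoiseSpace d =>
      2 ^ 7 * (1 + (3 * d : ℝ) ^ 7 * ∑ i, Real.exp (8 * c * |w i|))) (gaussianNoise d) :=
    ((integrable_const _).add ((integrable_finsetSum _ fun i _ => hi i).const_mul _)).const_mul _
  have hpos : ∀ w : NoiseSpace d, 0 ≤ noiseEnvelope c w :=
    fun w => zero_le_one.trans (one_le_noiseEnvelope c w)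
  have hJ : Integrable (fun w : NoiseSpace d => noiseEnvelope c w ^ 8) (gaussianNoise d) := by
    refine hI.mono' ((measurable_noiseEnvelope c).pow_const 8).aestronglyMeasurable
      (ae_of_all _ fun w => ?_)
    rw [Real.norm_eq_abs, abs_of_nonneg (pow_nonneg (hpos w) 8)]
    exact hb w
  refine ⟨hJ, (integral_mono hJ hI hb).trans ?_⟩
  rw [integral_const_mul, integral_add (integrable_const _)
    ((integrable_finsetSum _ fun i _ => hi i).const_mul _), integral_const_mul,
    integral_finsetSum _ fun i _ => hi i, Finset.sum_congr rfl fun i _ => he i]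
  simp only [integral_const, probReal_univ, smul_eq_mul, one_mul, Finset.sum_const,
    Finset.card_univ, Fintype.card_prod, Fintype.card_fin, nsmul_eq_mul]
  push_cast
  have h1 : (1 : ℝ) ≤ (d + 1) ^ 8 := one_le_pow₀ (by simp)
  have h2 : (d : ℝ) ^ 8 ≤ (d + 1) ^ 8 := by gcongr; simp
  calc (2 : ℝ) ^ 7 * (1 + (3 * d) ^ 7 * (3 * d * κ)) = 2 ^ 7 * (1 + 3 ^ 8 * κ * d ^ 8) := by ring
    _ ≤ 2 ^ 7 * (3 ^ 8 * (d + 1) ^ 8 + 3 ^ 8 * κ * (d + 1) ^ 8) := by gcongr; linarith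
    _ = _ := by ring

theorem euclidean_norm_le_sum {d : ℕ} (x : EuclideanSpace ℝ (Fin d)) : ‖x‖ ≤ ∑ k, |x k| := by
  rw [EuclideanSpace.norm_eq]
  refine Real.sqrt_le_iff.2 ⟨Finset.sum_nonneg fun _ _ => abs_nonneg _, ?_⟩
  exact Finset.sum_sq_le_sq_sum_of_nonneg fun _ _ => abs_nonneg _

/-- Adding 1 to |x| makes both kinds multiplicative: for the heat equation 1 + |x| + c ≤ (1 + |x|)(1
+ c) ≤ (1 + |x|)exp c. Transitions can thus be composed by multiplying exponentials. Here u is a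
Gaussian coordinate, and 1 + T stands for a bound of the square root of the time step. -/
theorem ForwardModel.one_add_abs_transition_le (M : ForwardModel) {T h : ℝ} (h0 : 0 ≤ h)
    (hT : h ≤ T) {d : ℕ} (x Δ : EuclideanSpace ℝ (Fin d)) (k : Fin d) {u : ℝ}
    (hΔ : |Δ k| ≤ (1 + T) * |u|) :
    1 + |M.transition h x Δ k| ≤ (1 + |x k|) *
      Real.exp ((1 + |M.μ| + |M.σ| + |M.μ - M.σ ^ 2 / 2|) * (1 + T) * (1 + |u|)) := by
  set c := (1 + |M.μ| + |M.σ| + |M.μ - M.σ ^ 2 / 2|) * (1 + T) * (1 + |u|) with hc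
  have hx := abs_nonneg (x k)
  have hT0 : 0 ≤ T := h0.trans hT
  have hσ : |M.σ * Δ k| ≤ |M.σ| * (1 + T) * |u| := by
    rw [abs_mul, mul_assoc]; gcongr
  have hμ : ∀ a : ℝ, |a * h| ≤ |a| * (1 + T) := fun a => by
    rw [abs_mul, abs_of_nonneg h0]; gcongr; linarith
  have hc1 : |M.μ| * (1 + T) + |M.σ| * (1 + T) * |u| ≤ c := by
    rw [hc, ← sub_nonneg]; ring_nf; positivity
  have hc2 : |M.μ - M.σ ^ 2 / 2| * (1 + T) + |M.σ| * (1 + T) * |u| ≤ c := by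
    have hz := abs_nonneg (M.μ - M.σ ^ 2 / 2)
    rw [hc]
    generalize |M.μ - M.σ ^ 2 / 2| = z at hz
    rw [← sub_nonneg]; ring_nf; positivity
  have hc0 : 0 ≤ c := le_trans (by positivity) hc1
  unfold ForwardModel.transition
  cases M.kind with
  | heat =>
    simp only
    have h1 : |x k + M.μ * h + M.σ * Δ k| ≤ |x k| + c := by
      refine (abs_add_three _ _ _).trans ?_
      linarith [hμ M.μ]
    nlinarith [Real.add_one_le_exp c]
  | blackScholes =>
    simp only
    have h1 : (M.μ - M.σ ^ 2 / 2) * h + M.σ * Δ k ≤ c :=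
      (le_abs_self _).trans ((abs_add_le _ _).trans (by linarith [hμ (M.μ - M.σ ^ 2 / 2)]))
    rw [abs_mul, abs_of_pos (Real.exp_pos _)]
    have h2 := mul_le_mul_of_nonneg_left (Real.exp_le_exp.2 h1) hx
    linarith [Real.one_le_exp hc0]

theorem ForwardModel.abs_init_le (M : ForwardModel) {d : ℕ} (w : NoiseSpace d) (k : Fin d) :
    |M.init w k| ≤ |M.a| + |M.b| := by
  have h0 := cdf_nonneg (gaussianReal 0 1) (w (0, k))
  have h1 := cdf_le_one (gaussianReal 0 1) (w (0, k))
  have e : M.init w k = cdf (gaussianReal 0 1) (w (0, k)) * M.b +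
      (1 - cdf (gaussianReal 0 1) (w (0, k))) * M.a := by
    simp only [ForwardModel.init]; ring
  rw [e]
  refine (abs_add_le _ _).trans ?_
  rw [abs_mul, abs_mul, abs_of_nonneg h0, abs_of_nonneg (sub_nonneg.2 h1)]
  nlinarith [abs_nonneg M.a, abs_nonneg M.b]

theorem sqrt_le_one_add {s T : ℝ} (h0 : 0 ≤ s) (hT : s ≤ T) : √s ≤ 1 + T :=
  Real.sqrt_le_iff.2 ⟨by linarith, by nlinarith⟩

theorem abs_sqrt_mul_le {s T u : ℝ} (h0 : 0 ≤ s) (hT : s ≤ T) : |√s * u| ≤ (1 + T) * |u| := by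
  rw [abs_mul, abs_of_nonneg (Real.sqrt_nonneg _)]
  gcongr
  exact sqrt_le_one_add h0 hT

/-- The initial value is bounded, since Φ takes values in [0, 1]. Two transitions then give a
product exp(c|w₁|)exp(c|w₂|), which is at most the sum of the squares of its factors; hence the rate
2c. The constants are uniform in the dimension and the times. -/
theorem exists_norm_state_le (M : ForwardModel) {T : ℝ} (hT : 0 ≤ T) :
    ∃ C c : ℝ, 1 ≤ C ∧ ∀ (d : ℕ) (t h : ℝ), 0 ≤ t → 0 ≤ h → t + h ≤ T → ∀ w : NoiseSpace d,
      1 + ‖M.stateAt t w‖ + ‖M.stateNext t h w‖ + ‖(brownianIncr h w : EuclideanSpace ℝ (Fin d))‖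
        ≤ C * noiseEnvelope c w := by
  set c := (1 + |M.μ| + |M.σ| + |M.μ - M.σ ^ 2 / 2|) * (1 + T) with hc
  have hc1 : 1 + T ≤ c := by
    rw [hc]
    refine le_mul_of_one_le_left (by linarith) ?_
    linarith [abs_nonneg M.μ, abs_nonneg M.σ, abs_nonneg (M.μ - M.σ ^ 2 / 2)]
  clear_value c
  set C := (1 + (|M.a| + |M.b|)) * Real.exp (2 * c) with hC
  have hc0 : 0 ≤ c := by linarith
  have hC1 : 1 ≤ C := one_le_mul_of_one_le_of_one_le
    (by linarith [abs_nonneg M.a, abs_nonneg M.b]) (Real.one_le_exp (by linarith))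
  refine ⟨3 * C, 2 * c, by linarith, fun d t h ht hh hth w => ?_⟩
  set F : Fin d → ℝ := fun k => Real.exp (2 * c * |w (1, k)|) + Real.exp (2 * c * |w (2, k)|)
    with hF
  have hsum : ∑ k, F k ≤ ∑ i, Real.exp (2 * c * |w i|) := by
    rw [Fintype.sum_prod_type, Fin.sum_univ_three, hF, Finset.sum_add_distrib]
    have : 0 ≤ ∑ k, Real.exp (2 * c * |w (0, k)|) :=
      Finset.sum_nonneg fun _ _ => (Real.exp_pos _).le
    linarith
  have hnorm : ∀ x : EuclideanSpace ℝ (Fin d), (∀ k, |x k| ≤ C * F k) →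
      ‖x‖ ≤ C * ∑ i, Real.exp (2 * c * |w i|) := fun x hx => by
    refine (euclidean_norm_le_sum x).trans ((Finset.sum_le_sum fun k _ => hx k).trans ?_)
    rw [← Finset.mul_sum]
    gcongr
  have hcoord : ∀ k, 1 + |M.stateAt t w k| ≤ C * F k ∧ 1 + |M.stateNext t h w k| ≤ C * F k ∧
      |(brownianIncr h w : EuclideanSpace ℝ (Fin d)) k| ≤ C * F k := by
    intro k
    set u := |w (1, k)| with hu
    set v := |w (2, k)| with hv
    have hu0 : 0 ≤ u := abs_nonneg _
    have hv0 : 0 ≤ v := abs_nonneg _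
    have h1 := M.one_add_abs_transition_le ht (by linarith : t ≤ T) (M.init w) (brownianAt t w) k
      (u := w (1, k)) (abs_sqrt_mul_le ht (by linarith))
    have h2 := M.one_add_abs_transition_le hh (by linarith : h ≤ T) (M.stateAt t w)
      (brownianIncr h w) k (u := w (2, k)) (abs_sqrt_mul_le hh (by linarith))
    have h3 : |(brownianIncr h w : EuclideanSpace ℝ (Fin d)) k| ≤ (1 + T) * v :=
      abs_sqrt_mul_le hh (by linarith)
    rw [← hc] at h1 h2
    change 1 + |M.stateAt t w k| ≤ _ at h1
    change 1 + |M.stateNext t h w k| ≤ _ at h2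
    have hin : 1 + |M.init w k| ≤ 1 + (|M.a| + |M.b|) := by linarith [M.abs_init_le w k]
    have hFk : Real.exp (c * u) * Real.exp (c * v) ≤ F k := by
      have e1 : Real.exp (2 * c * u) = Real.exp (c * u) ^ 2 := by
        rw [← Real.exp_nat_mul]; congr 1; push_cast; ring
      have e2 : Real.exp (2 * c * v) = Real.exp (c * v) ^ 2 := by
        rw [← Real.exp_nat_mul]; congr 1; push_cast; ring
      simp only [hF, ← hu, ← hv]
      rw [e1, e2]
      nlinarith [sq_nonneg (Real.exp (c * u) - Real.exp (c * v)), sq_nonneg (Real.exp (c * u)),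
        sq_nonneg (Real.exp (c * v))]
    have hnext : (1 + |M.init w k|) * Real.exp (c * (1 + u)) * Real.exp (c * (1 + v)) ≤
        C * F k := by
      have e3 : Real.exp (c * (1 + u)) * Real.exp (c * (1 + v)) =
          Real.exp (2 * c) * (Real.exp (c * u) * Real.exp (c * v)) := by
        simp only [← Real.exp_add]; congr 1; ring
      calc (1 + |M.init w k|) * Real.exp (c * (1 + u)) * Real.exp (c * (1 + v))
          = (1 + |M.init w k|) * Real.exp (2 * c) * (Real.exp (c * u) * Real.exp (c * v)) := by
            rw [mul_assoc, e3]; ring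
        _ ≤ C * F k := by
            refine mul_le_mul ?_ hFk (by positivity) (by positivity)
            exact mul_le_mul_of_nonneg_right hin (Real.exp_pos _).le
    have hone : 1 ≤ Real.exp (c * (1 + v)) := Real.one_le_exp (by positivity)
    have hX : 1 + |M.stateAt t w k| ≤ C * F k := by
      refine (h1.trans (le_mul_of_one_le_right (by positivity) hone)).trans hnext
    refine ⟨hX, (h2.trans (by gcongr)).trans hnext, h3.trans ?_⟩
    calc (1 + T) * v ≤ c * v := by gcongr
      _ ≤ Real.exp (c * v) := by linarith [Real.add_one_le_exp (c * v)]
      _ ≤ Real.exp (c * u) * Real.exp (c * v) :=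
        le_mul_of_one_le_left (Real.exp_pos _).le (Real.one_le_exp (by positivity))
      _ ≤ F k := hFk
      _ ≤ C * F k := le_mul_of_one_le_left (by positivity) hC1
  have n1 := hnorm _ fun k => (le_add_of_nonneg_left zero_le_one).trans (hcoord k).1
  have n2 := hnorm _ fun k => (le_add_of_nonneg_left zero_le_one).trans (hcoord k).2.1
  have n3 := hnorm _ fun k => (hcoord k).2.2
  have e : 3 * C * noiseEnvelope (2 * c) w = 3 * C + 3 * (C * ∑ i, Real.exp (2 * c * |w i|)) := by
    unfold noiseEnvelope; ring
  rw [e]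
  linarith

/-! ### Bounds for the loss -/

section NetBounds

variable {d : ℕ} {hs : List ℕ} {ρ v δ : ℝ}

theorem abs_ofLp_le (x : EuclideanSpace ℝ (Fin d)) (c : Fin d) : |x.ofLp c| ≤ 1 + ‖x‖ :=
  (PiLp.norm_apply_le x c).trans (by linarith)

theorem norm_le_of_abs_le (hd : (d : ℝ) + 1 ≤ v) {x : EuclideanSpace ℝ (Fin d)} {a : ℝ}
    (ha : 0 ≤ a) (hx : ∀ k, |x k| ≤ a) : ‖x‖ ≤ v * a := by
  refine (euclidean_norm_le_sum x).trans ((Finset.sum_le_card_nsmul _ _ a fun k _ => hx k).trans ?_)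
  simp only [Finset.card_univ, Fintype.card_fin, nsmul_eq_mul]
  gcongr
  linarith

theorem abs_scalarNet_le (hρ : 0 ≤ ρ) (hd : (d : ℝ) + 1 ≤ v) (hhs : ∀ h ∈ hs, (h : ℝ) + 1 ≤ v)
    {θ : NetIdx d hs 1 → ℝ} (hθ : ∀ i, |θ i| ≤ ρ) (x : EuclideanSpace ℝ (Fin d)) :
    |scalarNet θ x| ≤ ρ * v * (1 + ‖x‖) :=
  abs_net_le hρ (by linarith [norm_nonneg x]) hs hd hhs hθ (abs_ofLp_le x) 0

theorem norm_vectorNet_le (hρ : 0 ≤ ρ) (hd : (d : ℝ) + 1 ≤ v) (hhs : ∀ h ∈ hs, (h : ℝ) + 1 ≤ v)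
    {θ : NetIdx d hs d → ℝ} (hθ : ∀ i, |θ i| ≤ ρ) (x : EuclideanSpace ℝ (Fin d)) :
    ‖vectorNet θ x‖ ≤ v * (ρ * v * (1 + ‖x‖)) := by
  have hv : 0 ≤ v := le_trans (by positivity) hd
  exact norm_le_of_abs_le hd (by positivity) fun k =>
    abs_net_le hρ (by linarith [norm_nonneg x]) hs hd hhs hθ (abs_ofLp_le x) k

theorem abs_scalarNet_sub_le (hρ : 1 ≤ ρ) (hδ : 0 ≤ δ) (hd : (d : ℝ) + 1 ≤ v)
    (hhs : ∀ h ∈ hs, (h : ℝ) + 1 ≤ v) {θ θ' : NetIdx d hs 1 → ℝ} (hθ' : ∀ i, |θ' i| ≤ ρ)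
    (hθ : ∀ i, |θ i - θ' i| ≤ δ) (x : EuclideanSpace ℝ (Fin d)) :
    |scalarNet θ x - scalarNet θ' x| ≤ δ * (1 + ‖x‖) * (2 * ρ * v) ^ (hs.length + 1) := by
  have := abs_net_sub_le (x' := x.ofLp) hρ (by linarith [norm_nonneg x]) hδ hs hd hhs hθ' hθ
    (abs_ofLp_le x) le_rfl (fun c => by simp; positivity) (0 : Fin 1)
  rwa [one_mul] at this

theorem norm_vectorNet_sub_le (hρ : 1 ≤ ρ) (hδ : 0 ≤ δ) (hd : (d : ℝ) + 1 ≤ v)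
    (hhs : ∀ h ∈ hs, (h : ℝ) + 1 ≤ v) {θ θ' : NetIdx d hs d → ℝ} (hθ' : ∀ i, |θ' i| ≤ ρ)
    (hθ : ∀ i, |θ i - θ' i| ≤ δ) (x : EuclideanSpace ℝ (Fin d)) :
    ‖vectorNet θ x - vectorNet θ' x‖ ≤
      v * (δ * (1 + ‖x‖) * (2 * ρ * v) ^ (hs.length + 1)) := by
  have hv : 0 ≤ v := le_trans (by positivity) hd
  refine norm_le_of_abs_le hd (by positivity) fun k => ?_
  have := abs_net_sub_le (x' := x.ofLp) hρ (by linarith [norm_nonneg x]) hδ hs hd hhs hθ' hθ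
    (abs_ofLp_le x) le_rfl (fun c => by simp; positivity) k
  rwa [one_mul] at this

theorem continuous_scalarNet (θ : NetIdx d hs 1 → ℝ) :
    Continuous (scalarNet θ : EuclideanSpace ℝ (Fin d) → ℝ) :=
  (continuous_apply 0).comp ((continuous_net hs θ).comp (PiLp.continuous_ofLp 2 _))

theorem continuous_vectorNet (θ : NetIdx d hs d → ℝ) :
    Continuous (vectorNet θ : EuclideanSpace ℝ (Fin d) → EuclideanSpace ℝ (Fin d)) :=
  (PiLp.continuous_toLp 2 _).comp ((continuous_net hs θ).comp (PiLp.continuous_ofLp 2 _))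

end NetBounds

/-- Quantitative assumptions on a backward step: `κ` bounds the data, `ρ` the parameters and
`v` the layer sizes. -/
structure BackwardStep.Bounded {d : ℕ} (T κ ρ v : ℝ) (hs : List ℕ) (S : BackwardStep d) :
    Prop where
  t_nonneg : 0 ≤ S.t
  h_nonneg : 0 ≤ S.h
  add_le : S.t + S.h ≤ T
  one_le_κ : 1 ≤ κ
  one_le_ρ : 1 ≤ ρ
  input_le : (d : ℝ) + 1 ≤ v
  hidden_le : ∀ h ∈ hs, (h : ℝ) + 1 ≤ v
  lipschitz : LipschitzNonlinearity T κ S.f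
  f_zero_le : |S.f 0 0 0 0| ≤ κ
  Uhat_le : ∀ x, |S.Uhat x| ≤ κ * ρ * v * (1 + ‖x‖)
  continuous_Uhat : Continuous S.Uhat

/-- The residual whose square is the loss. -/
noncomputable def sampleResidual {d : ℕ} {hs : List ℕ} (M : ForwardModel) (S : BackwardStep d)
    (w : NoiseSpace d) (θ : PairParam d hs) : ℝ :=
  S.Uhat (M.stateNext S.t S.h w)
    - dbdpF S.f S.t (M.stateAt S.t w) (scalarNet θ.1 (M.stateAt S.t w))
        (vectorNet θ.2 (M.stateAt S.t w)) S.h (brownianIncr S.h w)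

theorem sampleLoss_eq_sq {d : ℕ} {hs : List ℕ} (M : ForwardModel) (S : BackwardStep d)
    (w : NoiseSpace d) (θ : PairParam d hs) :
    sampleLoss M S w θ = sampleResidual M S w θ ^ 2 := sq_abs _

/-- The size of the random quantities in the loss. -/
noncomputable def stateSize {d : ℕ} (M : ForwardModel) (t h : ℝ) (w : NoiseSpace d) : ℝ :=
  1 + ‖M.stateAt t w‖ + ‖M.stateNext t h w‖ + ‖(brownianIncr h w : EuclideanSpace ℝ (Fin d))‖

namespace BackwardStep.Bounded

variable {d : ℕ} {T κ ρ v : ℝ} {hs : List ℕ} {S : BackwardStep d}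

theorem one_le_v (hB : S.Bounded T κ ρ v hs) : 1 ≤ v := le_trans (by simp) hB.input_le

theorem T_nonneg (hB : S.Bounded T κ ρ v hs) : 0 ≤ T :=
  (add_nonneg hB.t_nonneg hB.h_nonneg).trans hB.add_le

theorem h_le (hB : S.Bounded T κ ρ v hs) : S.h ≤ T := by linarith [hB.t_nonneg, hB.add_le]

theorem t_mem (hB : S.Bounded T κ ρ v hs) : S.t ∈ Set.Icc 0 T :=
  ⟨hB.t_nonneg, by linarith [hB.h_nonneg, hB.add_le]⟩

/-- Lets the estimates be used on larger parameter cubes, as continuity of the risk at an arbitrary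
parameter requires. -/
theorem mono (hB : S.Bounded T κ ρ v hs) {ρ' : ℝ} (hρ : ρ ≤ ρ') : S.Bounded T κ ρ' v hs :=
  { hB with
    one_le_ρ := hB.one_le_ρ.trans hρ
    Uhat_le := fun x => (hB.Uhat_le x).trans (by
      have := hB.one_le_κ
      have := hB.one_le_v
      gcongr) }

/-- The product of Z, of linear growth in X, with the Brownian increment makes the bound quadratic
in `stateSize`. -/
theorem abs_sampleResidual_le (hB : S.Bounded T κ ρ v hs) (M : ForwardModel) (w : NoiseSpace d)
    {θ : PairParam d hs} (hθ : θ ∈ paramSpace d hs ρ) :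
    |sampleResidual M S w θ| ≤ (3 + T) ^ 2 * (κ * ρ * v ^ 2) * stateSize M S.t S.h w ^ 2 := by
  have hκ := hB.one_le_κ
  have hρ := hB.one_le_ρ
  have hv := hB.one_le_v
  have hT := hB.T_nonneg
  have hh := hB.h_nonneg
  obtain ⟨h1, h2⟩ := (mem_paramSpace (by linarith)).1 hθ
  unfold sampleResidual stateSize dbdpF
  set X := M.stateAt S.t w
  set X' := M.stateNext S.t S.h w
  set D : EuclideanSpace ℝ (Fin d) := brownianIncr S.h w
  set U := scalarNet θ.1 X with hU
  set Z := vectorNet θ.2 X with hZ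
  set Q := 1 + ‖X‖ + ‖X'‖ + ‖D‖ with hQ
  have nX := norm_nonneg X
  have nX' := norm_nonneg X'
  have nD := norm_nonneg D
  have hQ1 : 1 ≤ Q := by linarith
  have hXQ : 1 + ‖X‖ ≤ Q := by linarith
  have hXQ' : 1 + ‖X'‖ ≤ Q := by linarith
  have hDQ : ‖D‖ ≤ Q := by linarith
  -- A common majorant: since κ, ρ, v and Q are at least 1, every term is at most a multiple of G.
  -- The multiples add up to 3 + (5 + T)T ≤ (3 + T)².
  set G := κ * ρ * v ^ 2 * Q ^ 2 with hG
  have hQ2 : Q ≤ Q ^ 2 := le_self_pow₀ hQ1 two_ne_zero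
  have hv2 : v ≤ v ^ 2 := le_self_pow₀ hv two_ne_zero
  have bU' : |S.Uhat X'| ≤ G := (hB.Uhat_le X').trans (by rw [hG]; gcongr; exact hXQ'.trans hQ2)
  have bU : |U| ≤ ρ * v ^ 2 * Q :=
    (abs_scalarNet_le (by linarith) hB.input_le hB.hidden_le h1 X).trans (by gcongr)
  have bZ : ‖Z‖ ≤ ρ * v ^ 2 * Q :=
    (norm_vectorNet_le (by linarith) hB.input_le hB.hidden_le h2 X).trans (by
      rw [show v * (ρ * v * (1 + ‖X‖)) = ρ * v ^ 2 * (1 + ‖X‖) by ring]; gcongr)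
  have hρvQ : 1 ≤ ρ * v ^ 2 * Q ^ 2 :=
    one_le_mul_of_one_le_of_one_le (one_le_mul_of_one_le_of_one_le hρ (one_le_pow₀ hv))
      (one_le_pow₀ hQ1)
  have hκG : κ ≤ G := by
    rw [hG, show κ * ρ * v ^ 2 * Q ^ 2 = κ * (ρ * v ^ 2 * Q ^ 2) by ring]
    exact le_mul_of_one_le_right (by linarith) hρvQ
  have hκQ : κ * (ρ * v ^ 2 * Q) ≤ G := by
    rw [hG, show κ * ρ * v ^ 2 * Q ^ 2 = κ * (ρ * v ^ 2 * Q ^ 2) by ring]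
    gcongr
  have hQG : κ * Q ≤ G := le_trans (by
    gcongr
    exact le_mul_of_one_le_left (by linarith)
      (one_le_mul_of_one_le_of_one_le hρ (one_le_pow₀ hv))) hκQ
  have hG0 : 0 ≤ G := by linarith
  have hUG : |U| ≤ G := bU.trans ((le_mul_of_one_le_left (by positivity) hκ).trans hκQ)
  have bZD : |inner ℝ Z D| ≤ G := by
    refine (abs_real_inner_le_norm Z D).trans ?_
    calc ‖Z‖ * ‖D‖ ≤ ρ * v ^ 2 * Q * Q := by gcongr
      _ ≤ κ * (ρ * v ^ 2 * Q * Q) := le_mul_of_one_le_left (by positivity) hκ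
      _ = G := by rw [hG]; ring
  have bf : |S.f S.t X U Z| ≤ (5 + T) * G := by
    have h3 := hB.lipschitz S.t hB.t_mem 0 ⟨le_rfl, hT⟩ X 0 U 0 Z 0
    simp only [sub_zero] at h3
    have h4 : |S.f S.t X U Z| ≤ κ + κ * (√|S.t| + ‖X‖ + |U| + ‖Z‖) := by
      have := abs_sub_abs_le_abs_sub (S.f S.t X U Z) (S.f 0 0 0 0)
      linarith [hB.f_zero_le]
    have h5 : √|S.t| ≤ 1 + T := by
      rw [abs_of_nonneg hB.t_nonneg]; exact sqrt_le_one_add hB.t_nonneg hB.t_mem.2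
    calc |S.f S.t X U Z| ≤ κ + κ * ((1 + T) + Q + ρ * v ^ 2 * Q + ρ * v ^ 2 * Q) := by
          refine h4.trans ?_
          gcongr
          linarith
      _ = κ * (2 + T) + κ * Q + 2 * (κ * (ρ * v ^ 2 * Q)) := by ring
      _ ≤ G * (2 + T) + G + 2 * G := by gcongr
      _ = (5 + T) * G := by ring
  have bfh : |S.f S.t X U Z * S.h| ≤ (5 + T) * G * T := by
    rw [abs_mul, abs_of_nonneg hh]
    gcongr
    exact hB.h_le
  calc |S.Uhat X' - (U - S.f S.t X U Z * S.h + inner ℝ Z D)|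
      ≤ |S.Uhat X'| + |U| + |S.f S.t X U Z * S.h| + |inner ℝ Z D| := by
        simp only [abs_le]
        constructor <;>
        linarith [le_abs_self (S.Uhat X'), neg_abs_le (S.Uhat X'), le_abs_self U, neg_abs_le U,
          le_abs_self (S.f S.t X U Z * S.h), neg_abs_le (S.f S.t X U Z * S.h),
          le_abs_self (inner ℝ Z D), neg_abs_le (inner ℝ Z D)]
    _ ≤ G + G + (5 + T) * G * T + G := by gcongr
    _ ≤ (3 + T) ^ 2 * (κ * ρ * v ^ 2) * Q ^ 2 := by
        rw [show (3 + T) ^ 2 * (κ * ρ * v ^ 2) * Q ^ 2 = (3 + T) ^ 2 * G by rw [hG]; ring]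
        nlinarith [mul_nonneg hT hG0]

/-- `S.Uhat` cancels and f is compared at equal times and states, so only the two network
differences remain. The last factor is the bound of `abs_sampleResidual_le`, ready for the
factorization of a difference of squares. -/
theorem abs_sampleResidual_sub_le (hB : S.Bounded T κ ρ v hs) (M : ForwardModel)
    (w : NoiseSpace d) {θ θ' : PairParam d hs} (hθ' : θ' ∈ paramSpace d hs ρ) :
    |sampleResidual M S w θ - sampleResidual M S w θ'| ≤
      ‖θ - θ'‖ * (2 * ρ * v) ^ (hs.length + 1) *
        ((3 + T) ^ 2 * (κ * ρ * v ^ 2) * stateSize M S.t S.h w ^ 2) := by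
  have hκ := hB.one_le_κ
  have hρ := hB.one_le_ρ
  have hv := hB.one_le_v
  have hT := hB.T_nonneg
  have hh := hB.h_nonneg
  obtain ⟨h1, h2⟩ := (mem_paramSpace (by linarith)).1 hθ'
  set δ := ‖θ - θ'‖ with hδ
  have hδ0 : 0 ≤ δ := norm_nonneg _
  obtain ⟨h3, h4⟩ := (mem_paramSpace (R := δ) (θ := θ - θ') hδ0).1 (le_refl δ)
  unfold sampleResidual stateSize dbdpF
  set X := M.stateAt S.t w
  set X' := M.stateNext S.t S.h w
  set D : EuclideanSpace ℝ (Fin d) := brownianIncr S.h w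
  have bU := abs_scalarNet_sub_le hρ hδ0 hB.input_le hB.hidden_le h1 h3 X
  have bZ := norm_vectorNet_sub_le hρ hδ0 hB.input_le hB.hidden_le h2 h4 X
  set U := scalarNet θ.1 X
  set Z := vectorNet θ.2 X
  set U' := scalarNet θ'.1 X
  set Z' := vectorNet θ'.2 X
  set Q := 1 + ‖X‖ + ‖X'‖ + ‖D‖ with hQ
  have nX := norm_nonneg X
  have nX' := norm_nonneg X'
  have nD := norm_nonneg D
  have hQ1 : 1 ≤ Q := by linarith
  have hXQ : 1 + ‖X‖ ≤ Q := by linarith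
  have hDQ : ‖D‖ ≤ Q := by linarith
  set L := δ * (2 * ρ * v) ^ (hs.length + 1) with hL
  have hL0 : 0 ≤ L := by positivity
  have bU2 : |U - U'| ≤ v * (L * Q) := by
    refine bU.trans ?_
    rw [show δ * (1 + ‖X‖) * (2 * ρ * v) ^ (hs.length + 1) = 1 * (L * (1 + ‖X‖)) by rw [hL]; ring]
    gcongr
  have bZ2 : ‖Z - Z'‖ ≤ v * (L * Q) := by
    refine bZ.trans ?_
    rw [show δ * (1 + ‖X‖) * (2 * ρ * v) ^ (hs.length + 1) = L * (1 + ‖X‖) by rw [hL]; ring]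
    gcongr
  have bf : |S.f S.t X U Z - S.f S.t X U' Z'| ≤ κ * (v * (L * Q) + v * (L * Q)) := by
    have h5 := hB.lipschitz S.t hB.t_mem S.t hB.t_mem X X U U' Z Z'
    simp only [sub_self, abs_zero, Real.sqrt_zero, norm_zero, zero_add] at h5
    exact h5.trans (by gcongr)
  have bfh : |(S.f S.t X U Z - S.f S.t X U' Z') * S.h| ≤
      κ * (v * (L * Q) + v * (L * Q)) * T := by
    rw [abs_mul, abs_of_nonneg hh]
    gcongr
    exact hB.h_le
  have bZD : |inner ℝ (Z - Z') D| ≤ v * (L * Q) * Q :=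
    (abs_real_inner_le_norm _ _).trans (by gcongr)
  set G := κ * ρ * v ^ 2 * Q ^ 2 with hG
  have hvQ : v * Q ^ 2 ≤ ρ * v ^ 2 * Q ^ 2 := by
    gcongr
    exact (le_self_pow₀ hv two_ne_zero).trans (le_mul_of_one_le_left (by positivity) hρ)
  have g1 : κ * (v * Q ^ 2) ≤ G := by
    rw [hG, show κ * ρ * v ^ 2 * Q ^ 2 = κ * (ρ * v ^ 2 * Q ^ 2) by ring]
    gcongr
  have g2 : κ * (v * Q) ≤ G := le_trans (by gcongr; exact le_self_pow₀ hQ1 two_ne_zero) g1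
  have g3 : v * Q ≤ G := (le_mul_of_one_le_left (by positivity) hκ).trans g2
  have g4 : v * Q ^ 2 ≤ G := (le_mul_of_one_le_left (by positivity) hκ).trans g1
  have hG0 : 0 ≤ G := by positivity
  have e : S.Uhat X' - (U - S.f S.t X U Z * S.h + inner ℝ Z D) -
      (S.Uhat X' - (U' - S.f S.t X U' Z' * S.h + inner ℝ Z' D)) =
      -(U - U') + (S.f S.t X U Z - S.f S.t X U' Z') * S.h + -inner ℝ (Z - Z') D := by
    rw [inner_sub_left]; ring
  rw [e]
  calc |-(U - U') + (S.f S.t X U Z - S.f S.t X U' Z') * S.h + -inner ℝ (Z - Z') D|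
      ≤ v * (L * Q) + κ * (v * (L * Q) + v * (L * Q)) * T + v * (L * Q) * Q := by
        refine (abs_add_three _ _ _).trans ?_
        rw [abs_neg, abs_neg]
        gcongr
    _ = L * (v * Q + 2 * (κ * (v * Q)) * T + v * Q ^ 2) := by ring
    _ ≤ L * (G + 2 * G * T + G) := by gcongr
    _ ≤ L * ((3 + T) ^ 2 * (κ * ρ * v ^ 2) * Q ^ 2) := by
        gcongr
        rw [show (3 + T) ^ 2 * (κ * ρ * v ^ 2) * Q ^ 2 = (3 + T) ^ 2 * G by rw [hG]; ring]
        nlinarith [mul_nonneg hT hG0]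

theorem abs_sampleLoss_sub_le (hB : S.Bounded T κ ρ v hs) (M : ForwardModel)
    (w : NoiseSpace d) {θ θ' : PairParam d hs} (hθ : θ ∈ paramSpace d hs ρ)
    (hθ' : θ' ∈ paramSpace d hs ρ) :
    |sampleLoss M S w θ - sampleLoss M S w θ'| ≤
      2 * ‖θ - θ'‖ * (2 * ρ * v) ^ (hs.length + 1) *
        ((3 + T) ^ 2 * (κ * ρ * v ^ 2) * stateSize M S.t S.h w ^ 2) ^ 2 := by
  have b1 := hB.abs_sampleResidual_le M w hθ
  have b2 := hB.abs_sampleResidual_le M w hθ'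
  have b3 := hB.abs_sampleResidual_sub_le M w (θ := θ) hθ'
  set K := (3 + T) ^ 2 * (κ * ρ * v ^ 2) * stateSize M S.t S.h w ^ 2
  have hK : 0 ≤ K := (abs_nonneg _).trans b1
  rw [sampleLoss_eq_sq, sampleLoss_eq_sq, sq_sub_sq, abs_mul]
  calc |sampleResidual M S w θ + sampleResidual M S w θ'| *
        |sampleResidual M S w θ - sampleResidual M S w θ'|
      ≤ (K + K) * (‖θ - θ'‖ * (2 * ρ * v) ^ (hs.length + 1) * K) := by
        refine mul_le_mul ((abs_add_le _ _).trans (add_le_add b1 b2)) b3 (abs_nonneg _)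
          (by positivity)
    _ = _ := by ring

end BackwardStep.Bounded

section Measurability

variable {d : ℕ} (M : ForwardModel)

theorem measurable_init : Measurable (M.init : NoiseSpace d → EuclideanSpace ℝ (Fin d)) := by
  refine (PiLp.continuous_toLp 2 _).measurable.comp (measurable_pi_lambda _ fun k => ?_)
  exact (((monotone_cdf (gaussianReal 0 1)).measurable.comp
    (measurable_pi_apply (0, k))).const_mul _).add_const _

theorem continuous_transition (h : ℝ) :
    Continuous fun p : EuclideanSpace ℝ (Fin d) × EuclideanSpace ℝ (Fin d) =>
      M.transition h p.1 p.2 := by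
  unfold ForwardModel.transition
  cases M.kind <;> exact (PiLp.continuous_toLp 2 _).comp (by fun_prop)

theorem continuous_brownianAt (t : ℝ) :
    Continuous (brownianAt t : NoiseSpace d → EuclideanSpace ℝ (Fin d)) :=
  (PiLp.continuous_toLp 2 _).comp (by fun_prop)

theorem continuous_brownianIncr (h : ℝ) :
    Continuous (brownianIncr h : NoiseSpace d → EuclideanSpace ℝ (Fin d)) :=
  (PiLp.continuous_toLp 2 _).comp (by fun_prop)

theorem measurable_stateAt (t : ℝ) :
    Measurable (M.stateAt t : NoiseSpace d → EuclideanSpace ℝ (Fin d)) :=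
  (continuous_transition M t).measurable.comp
    ((measurable_init M).prodMk (continuous_brownianAt t).measurable)

theorem measurable_stateNext (t h : ℝ) :
    Measurable (M.stateNext t h : NoiseSpace d → EuclideanSpace ℝ (Fin d)) :=
  (continuous_transition M h).measurable.comp
    ((measurable_stateAt M t).prodMk (continuous_brownianIncr h).measurable)

theorem LipschitzNonlinearity.continuous {T Cf : ℝ}
    {f : ℝ → EuclideanSpace ℝ (Fin d) → ℝ → EuclideanSpace ℝ (Fin d) → ℝ} (hCf : 0 ≤ Cf)
    (hf : LipschitzNonlinearity T Cf f) {t : ℝ} (ht : t ∈ Set.Icc 0 T) :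
    Continuous fun p : EuclideanSpace ℝ (Fin d) × ℝ × EuclideanSpace ℝ (Fin d) =>
      f t p.1 p.2.1 p.2.2 := by
  refine (LipschitzWith.of_dist_le' (K := Cf * 3) fun p q => ?_).continuous
  have h := hf t ht t ht p.1 q.1 p.2.1 q.2.1 p.2.2 q.2.2
  simp only [sub_self, abs_zero, Real.sqrt_zero, zero_add] at h
  have h1 : ‖p.1 - q.1‖ ≤ ‖p - q‖ := norm_fst_le (p - q)
  have h2 : ‖p.2 - q.2‖ ≤ ‖p - q‖ := norm_snd_le (p - q)
  have h3 : |p.2.1 - q.2.1| ≤ ‖p.2 - q.2‖ := norm_fst_le (p.2 - q.2)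
  have h4 : ‖p.2.2 - q.2.2‖ ≤ ‖p.2 - q.2‖ := norm_snd_le (p.2 - q.2)
  rw [Real.dist_eq, dist_eq_norm, mul_assoc]
  refine h.trans ?_
  gcongr
  linarith

theorem BackwardStep.Bounded.measurable_sampleLoss {T κ ρ v : ℝ} {hs : List ℕ}
    {S : BackwardStep d} (hB : S.Bounded T κ ρ v hs) (θ : PairParam d hs) :
    Measurable fun w => sampleLoss M S w θ := by
  have hX := measurable_stateAt (d := d) M S.t
  have hX' := measurable_stateNext (d := d) M S.t S.h
  have hD := (continuous_brownianIncr (d := d) S.h).measurable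
  have hU := (continuous_scalarNet θ.1).measurable.comp hX
  have hZ := (continuous_vectorNet θ.2).measurable.comp hX
  have hF := (hB.lipschitz.continuous (zero_le_one.trans hB.one_le_κ) hB.t_mem).measurable.comp
    (hX.prodMk (hU.prodMk hZ))
  have hI := hZ.inner (𝕜 := ℝ) hD
  have hV := hB.continuous_Uhat.measurable.comp hX'
  simp only [sampleLoss_eq_sq]
  exact (hV.sub ((hU.sub (hF.mul_const S.h)).add hI)).pow_const 2

end Measurability

/-! ### Regularity of the risk -/

namespace BackwardStep.Bounded

variable {d : ℕ} {T κ ρ v : ℝ} {hs : List ℕ} {S : BackwardStep d} {M : ForwardModel} {C c C₈ : ℝ}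

theorem sampleLoss_le (hB : S.Bounded T κ ρ v hs)
    (hE : ∀ w : NoiseSpace d, stateSize M S.t S.h w ≤ C * noiseEnvelope c w)
    {θ : PairParam d hs} (hθ : θ ∈ paramSpace d hs ρ) (w : NoiseSpace d) :
    sampleLoss M S w θ ≤ ((3 + T) ^ 2 * C ^ 2 * (κ * ρ * v ^ 2)) ^ 2 * noiseEnvelope c w ^ 4 := by
  have hκ := hB.one_le_κ
  have hρ := hB.one_le_ρ
  have hv := hB.one_le_v
  have hQ : 0 ≤ stateSize M S.t S.h w := by unfold stateSize; positivity
  rw [sampleLoss_eq_sq, ← sq_abs]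
  calc |sampleResidual M S w θ| ^ 2
      ≤ ((3 + T) ^ 2 * (κ * ρ * v ^ 2) * (C * noiseEnvelope c w) ^ 2) ^ 2 := by
        refine pow_le_pow_left₀ (abs_nonneg _) ((hB.abs_sampleResidual_le M w hθ).trans ?_) 2
        gcongr
        exact hE w
    _ = _ := by ring

theorem abs_sampleLoss_sub_le_envelope (hB : S.Bounded T κ ρ v hs)
    (hE : ∀ w : NoiseSpace d, stateSize M S.t S.h w ≤ C * noiseEnvelope c w)
    {θ θ' : PairParam d hs} (hθ : θ ∈ paramSpace d hs ρ) (hθ' : θ' ∈ paramSpace d hs ρ)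
    (w : NoiseSpace d) :
    |sampleLoss M S w θ - sampleLoss M S w θ'| ≤ ‖θ - θ'‖ * (2 * (2 * ρ * v) ^ (hs.length + 1) *
        ((3 + T) ^ 2 * C ^ 2 * (κ * ρ * v ^ 2)) ^ 2 * noiseEnvelope c w ^ 8) := by
  have hκ := hB.one_le_κ
  have hρ := hB.one_le_ρ
  have hv := hB.one_le_v
  have hQ : 0 ≤ stateSize M S.t S.h w := by unfold stateSize; positivity
  have h1 := one_le_noiseEnvelope c w
  calc |sampleLoss M S w θ - sampleLoss M S w θ'|
      ≤ 2 * ‖θ - θ'‖ * (2 * ρ * v) ^ (hs.length + 1) *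
        ((3 + T) ^ 2 * (κ * ρ * v ^ 2) * (C * noiseEnvelope c w) ^ 2) ^ 2 := by
        refine (hB.abs_sampleLoss_sub_le M w hθ hθ').trans ?_
        gcongr
        exact hE w
    _ = ‖θ - θ'‖ * (2 * (2 * ρ * v) ^ (hs.length + 1) *
        ((3 + T) ^ 2 * C ^ 2 * (κ * ρ * v ^ 2)) ^ 2 * noiseEnvelope c w ^ 4) := by ring
    -- The power 4 is weakened to 8, the envelope being at least 1, so that one moment serves both
    -- the Lipschitz constant and the second moment.
    _ ≤ _ := by
        gcongr
        norm_num

theorem sq_sampleLoss_le (hB : S.Bounded T κ ρ v hs)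
    (hE : ∀ w : NoiseSpace d, stateSize M S.t S.h w ≤ C * noiseEnvelope c w)
    {θ : PairParam d hs} (hθ : θ ∈ paramSpace d hs ρ) (w : NoiseSpace d) :
    sampleLoss M S w θ ^ 2 ≤
      ((3 + T) ^ 2 * C ^ 2 * (κ * ρ * v ^ 2)) ^ 4 * noiseEnvelope c w ^ 8 := by
  have h0 : 0 ≤ sampleLoss M S w θ := by rw [sampleLoss_eq_sq]; positivity
  refine (pow_le_pow_left₀ h0 (hB.sampleLoss_le hE hθ w) 2).trans_eq ?_
  ring

theorem integrable_sq_sampleLoss (hB : S.Bounded T κ ρ v hs)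
    (hE : ∀ w : NoiseSpace d, stateSize M S.t S.h w ≤ C * noiseEnvelope c w)
    (hI : Integrable (fun w : NoiseSpace d => noiseEnvelope c w ^ 8) (gaussianNoise d))
    {θ : PairParam d hs} (hθ : θ ∈ paramSpace d hs ρ) :
    Integrable (fun w => sampleLoss M S w θ ^ 2) (gaussianNoise d) := by
  refine (hI.const_mul (((3 + T) ^ 2 * C ^ 2 * (κ * ρ * v ^ 2)) ^ 4)).mono'
    ((hB.measurable_sampleLoss M θ).pow_const 2).aestronglyMeasurable (ae_of_all _ fun w => ?_)
  rw [Real.norm_eq_abs, abs_of_nonneg (sq_nonneg _)]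
  exact hB.sq_sampleLoss_le hE hθ w

theorem integral_sq_sampleLoss_le (hB : S.Bounded T κ ρ v hs)
    (hE : ∀ w : NoiseSpace d, stateSize M S.t S.h w ≤ C * noiseEnvelope c w)
    (hI : Integrable (fun w : NoiseSpace d => noiseEnvelope c w ^ 8) (gaussianNoise d))
    {θ : PairParam d hs} (hθ : θ ∈ paramSpace d hs ρ) :
    ∫ w, sampleLoss M S w θ ^ 2 ∂gaussianNoise d ≤
      ((3 + T) ^ 2 * C ^ 2 * (κ * ρ * v ^ 2)) ^ 4 *
        ∫ w : NoiseSpace d, noiseEnvelope c w ^ 8 ∂gaussianNoise d := by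
  rw [← integral_const_mul]
  exact integral_mono (hB.integrable_sq_sampleLoss hE hI hθ) (hI.const_mul _)
    (hB.sq_sampleLoss_le hE hθ)

theorem integrable_sampleLoss (hB : S.Bounded T κ ρ v hs)
    (hE : ∀ w : NoiseSpace d, stateSize M S.t S.h w ≤ C * noiseEnvelope c w)
    (hI : Integrable (fun w : NoiseSpace d => noiseEnvelope c w ^ 8) (gaussianNoise d))
    {θ : PairParam d hs} (hθ : θ ∈ paramSpace d hs ρ) :
    Integrable (fun w => sampleLoss M S w θ) (gaussianNoise d) :=
  integrable_of_integrable_sq (hB.measurable_sampleLoss M θ)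
    (hB.integrable_sq_sampleLoss hE hI hθ)

theorem exists_abs_risk_sub_le (hB : S.Bounded T κ ρ v hs)
    (hE : ∀ w : NoiseSpace d, stateSize M S.t S.h w ≤ C * noiseEnvelope c w)
    (hI : Integrable (fun w : NoiseSpace d => noiseEnvelope c w ^ 8) (gaussianNoise d)) :
    ∃ L : ℝ, ∀ θ ∈ paramSpace d hs ρ, ∀ θ' ∈ paramSpace d hs ρ,
      |risk M S θ - risk M S θ'| ≤ ‖θ - θ'‖ * L := by
  refine ⟨∫ w : NoiseSpace d, 2 * (2 * ρ * v) ^ (hs.length + 1) *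
    ((3 + T) ^ 2 * C ^ 2 * (κ * ρ * v ^ 2)) ^ 2 * noiseEnvelope c w ^ 8 ∂gaussianNoise d,
    fun θ hθ θ' hθ' => ?_⟩
  unfold risk
  rw [← integral_sub (hB.integrable_sampleLoss hE hI hθ) (hB.integrable_sampleLoss hE hI hθ'),
    ← integral_const_mul]
  rw [← Real.norm_eq_abs]
  refine norm_integral_le_of_norm_le ((hI.const_mul _).const_mul _) (ae_of_all _ fun w => ?_)
  exact hB.abs_sampleLoss_sub_le_envelope hE hθ hθ' w

/-- Continuity is needed on the whole space: the random minimizer lies in the cube only almost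
surely, and the risk is composed with it to get measurability. Near `θ₀` the Lipschitz estimate is
applied on a cube of radius at least ‖θ₀‖ + 1. -/
theorem continuous_risk (hB : S.Bounded T κ ρ v hs)
    (hE : ∀ w : NoiseSpace d, stateSize M S.t S.h w ≤ C * noiseEnvelope c w)
    (hI : Integrable (fun w : NoiseSpace d => noiseEnvelope c w ^ 8) (gaussianNoise d)) :
    Continuous (risk M S : PairParam d hs → ℝ) := by
  refine continuous_iff_continuousAt.2 fun θ₀ => ?_
  obtain ⟨L, hL⟩ := (hB.mono (le_max_left ρ (‖θ₀‖ + 1))).exists_abs_risk_sub_le hE hI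
  refine tendsto_iff_dist_tendsto_zero.2 (squeeze_zero' (g := fun θ => ‖θ - θ₀‖ * L)
    (Filter.Eventually.of_forall fun _ => dist_nonneg) ?_ ?_)
  · filter_upwards [Metric.ball_mem_nhds θ₀ one_pos] with θ hθ
    rw [Metric.mem_ball, dist_eq_norm] at hθ
    refine hL θ ?_ θ₀ ((by linarith : ‖θ₀‖ ≤ ‖θ₀‖ + 1).trans (le_max_right _ _))
    have := norm_sub_norm_le θ θ₀
    exact (by linarith : ‖θ‖ ≤ ‖θ₀‖ + 1).trans (le_max_right _ _)
  · have : Continuous fun θ : PairParam d hs => ‖θ - θ₀‖ * L := by fun_prop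
    simpa using this.tendsto θ₀

/-- The excess risk of an almost surely admissible parameter is integrable. -/
theorem integrable_excess_risk (hB : S.Bounded T κ ρ v hs)
    (hE : ∀ w : NoiseSpace d, stateSize M S.t S.h w ≤ C * noiseEnvelope c w)
    (hI : Integrable (fun w : NoiseSpace d => noiseEnvelope c w ^ 8) (gaussianNoise d))
    {Ω : Type*} [MeasurableSpace Ω] {P : Measure Ω} [IsProbabilityMeasure P]
    {θm : Ω → PairParam d hs} (hθm : AEMeasurable θm P)
    (hmem : ∀ᵐ ω ∂P, θm ω ∈ paramSpace d hs ρ) {θ' : PairParam d hs}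
    (hθ' : θ' ∈ paramSpace d hs ρ) :
    Integrable (fun ω => risk M S (θm ω) - risk M S θ') P := by
  obtain ⟨L, hL⟩ := hB.exists_abs_risk_sub_le hE hI
  have hmeas : Measurable (risk M S : PairParam d hs → ℝ) := by
    have : Countable (NetIdx d hs 1) := Finite.to_countable
    have : Countable (NetIdx d hs d) := Finite.to_countable
    exact (hB.continuous_risk hE hI).measurable
  refine Integrable.of_bound (C := 2 * ρ * |L|)
    ((hmeas.comp_aemeasurable hθm).sub_const _).aestronglyMeasurable ?_
  filter_upwards [hmem] with ω hω
  refine (hL _ hω _ hθ').trans ?_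
  have h1 : ‖θm ω - θ'‖ ≤ 2 * ρ := by
    have h2 : ‖θm ω‖ ≤ ρ := hω
    have h3 : ‖θ'‖ ≤ ρ := hθ'
    linarith [norm_sub_le (θm ω) θ']
  calc ‖θm ω - θ'‖ * L ≤ ‖θm ω - θ'‖ * |L| := by gcongr; exact le_abs_self L
    _ ≤ 2 * ρ * |L| := by gcongr

end BackwardStep.Bounded

/-! ### Data of the theorem -/

/-- `constFG` bounds squares; using 1 + q instead of the square root of q keeps the constants
polynomial. -/
theorem abs_le_one_add_of_sq_le {x q : ℝ} (h : x ^ 2 ≤ q) : |x| ≤ 1 + q := by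
  have := sq_abs x
  nlinarith [sq_nonneg (|x| - 1)]

theorem LipschitzTerminal.continuous {d : ℕ} {Cg : ℝ} {g : EuclideanSpace ℝ (Fin d) → ℝ}
    (hg : LipschitzTerminal Cg g) : Continuous g :=
  (LipschitzWith.of_dist_le' (K := Cg) fun x y => by
    rw [Real.dist_eq, dist_eq_norm]; exact hg x y).continuous

theorem LipschitzNonlinearity.mono {d : ℕ} {T C C' : ℝ}
    {f : ℝ → EuclideanSpace ℝ (Fin d) → ℝ → EuclideanSpace ℝ (Fin d) → ℝ}
    (hf : LipschitzNonlinearity T C f) (h : C ≤ C') : LipschitzNonlinearity T C' f :=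
  fun t₁ h₁ t₂ h₂ x₁ x₂ y₁ y₂ z₁ z₂ => (hf t₁ h₁ t₂ h₂ x₁ x₂ y₁ y₂ z₁ z₂).trans (by gcongr)

/-- Each quantity is increased by 1 so that it is at least 1 and can be absorbed in products; for
the width the extra 1 also counts the bias. -/
theorem bounded_backwardStep {d : ℕ} {hs : List ℕ} {R T Cf Cg t h : ℝ} (hR : 0 ≤ R)
    {f : ℝ → EuclideanSpace ℝ (Fin d) → ℝ → EuclideanSpace ℝ (Fin d) → ℝ}
    {g Uhat : EuclideanSpace ℝ (Fin d) → ℝ}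
    (hf : LipschitzNonlinearity T Cf f) (hg : LipschitzTerminal Cg g)
    (ht : 0 ≤ t) (hh : 0 ≤ h) (hth : t + h ≤ T)
    (hU : Uhat = g ∨ ∃ ϑ : NetIdx d hs 1 → ℝ, ‖ϑ‖ ≤ R ∧ Uhat = scalarNet ϑ) :
    ({ f := f, t := t, h := h, Uhat := Uhat } : BackwardStep d).Bounded T
      (1 + constFG Cf Cg f g) (1 + R) (1 + netWidth d hs 1) hs := by
  have q1 : Cf ^ 2 ≤ constFG Cf Cg f g := (le_max_left _ _).trans (le_max_left _ _)
  have q2 : Cg ^ 2 ≤ constFG Cf Cg f g := (le_max_right _ _).trans (le_max_left _ _)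
  have q3 : f 0 0 0 0 ^ 2 ≤ constFG Cf Cg f g := (le_max_left _ _).trans (le_max_right _ _)
  have q4 : g 0 ^ 2 ≤ constFG Cf Cg f g := (le_max_right _ _).trans (le_max_right _ _)
  set q := constFG Cf Cg f g
  have hq : 0 ≤ q := (sq_nonneg Cf).trans q1
  have hw : ∀ k ∈ d :: 1 :: hs, (k : ℝ) + 1 ≤ 1 + netWidth d hs 1 := fun k hk => by
    have : (k : ℝ) ≤ netWidth d hs 1 := by exact_mod_cast le_foldr_max hk
    linarith
  have hv : (1 : ℝ) ≤ 1 + netWidth d hs 1 := by simp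
  exact
    { t_nonneg := ht
      h_nonneg := hh
      add_le := hth
      one_le_κ := by linarith
      one_le_ρ := by linarith
      input_le := hw d (by simp)
      hidden_le := fun k hk => hw k (by simp [hk])
      lipschitz := hf.mono ((le_abs_self _).trans (abs_le_one_add_of_sq_le q1))
      f_zero_le := abs_le_one_add_of_sq_le q3
      Uhat_le := fun x => by
        have hx := norm_nonneg x
        rcases hU with rfl | ⟨ϑ, hϑ, rfl⟩
        · have h1 := hg x 0
          rw [sub_zero] at h1
          have h2 := abs_sub_abs_le_abs_sub (Uhat x) (Uhat 0)
          have h3 := (le_abs_self _).trans (abs_le_one_add_of_sq_le q2)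
          calc |Uhat x| ≤ (1 + q) + Cg * ‖x‖ := by linarith [abs_le_one_add_of_sq_le q4]
            _ ≤ (1 + q) + (1 + q) * ‖x‖ := by gcongr
            _ = (1 + q) * (1 + ‖x‖) := by ring
            _ ≤ _ := by
              rw [mul_assoc (1 + q)]
              gcongr
              exact le_mul_of_one_le_right (by positivity)
                (one_le_mul_of_one_le_of_one_le (by linarith) hv)
        · refine (abs_scalarNet_le (ρ := 1 + R) (by linarith) (hw d (by simp))
            (fun k hk => hw k (by simp [hk])) (fun i => ?_) x).trans ?_
          · exact (norm_le_pi_norm ϑ i).trans (by linarith)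
          · gcongr
            exact le_mul_of_one_le_left (by positivity) (by linarith)
      continuous_Uhat := by
        rcases hU with rfl | ⟨ϑ, hϑ, rfl⟩
        · exact hg.continuous
        · exact continuous_scalarNet ϑ }

/-! ### Choice of the mesh and assembly of the bound. -/

/-- Turns terms without a logarithm into multiples of log m; this is where m ≥ 2 is used. -/
theorem half_le_log {m : ℕ} (hm : 2 ≤ m) : 1 / 2 ≤ Real.log m := by
  have := Real.log_le_log two_pos (by exact_mod_cast hm : (2 : ℝ) ≤ m)
  linarith [Real.log_two_gt_d9]

/-- The covering number of the parameter space at the mesh chosen in the proof grows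
logarithmically in the sample size. -/
theorem log_card_grid_le {d : ℕ} {hs : List ℕ} [DecidableEq (NetIdx d hs 1)]
    [DecidableEq (NetIdx d hs d)] {b v : ℝ} (hb : 1 ≤ b) (hd : (d : ℝ) + 1 ≤ v)
    (hhs : ∀ h ∈ hs, (h : ℝ) + 1 ≤ v) (h1 : (1 : ℝ) + 1 ≤ v) {m : ℕ} (hm : 2 ≤ m) {n : ℕ}
    (hn : (n : ℝ) ≤ b ^ netDepth hs * √m + 1) :
    Real.log (Fintype.card (NetIdx d hs 1 ⊕ NetIdx d hs d → Fin (n + 1))) ≤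
      2 * netDepth hs * v ^ 2 * (7 + 2 * netDepth hs * b) * Real.log m := by
  have hm2 : (2 : ℝ) ≤ m := by exact_mod_cast hm
  have hlog := half_le_log hm
  have hcard : (Fintype.card (NetIdx d hs 1 ⊕ NetIdx d hs d) : ℝ) ≤ 2 * netDepth hs * v ^ 2 := by
    rw [Fintype.card_sum]
    have c1 := card_netIdx_le hs (p := 1) hd hhs (by simpa using h1)
    have c2 := card_netIdx_le hs (p := d) hd hhs hd
    unfold netDepth
    push_cast
    linarith
  have hbk : 1 ≤ b ^ netDepth hs := one_le_pow₀ hb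
  have hsm : √(m : ℝ) ≤ m := Real.sqrt_le_iff.2 ⟨by linarith, by nlinarith⟩
  have hn1 : (n : ℝ) + 1 ≤ 3 * b ^ netDepth hs * m := by
    have : b ^ netDepth hs * √m ≤ b ^ netDepth hs * m := by gcongr
    nlinarith
  have hlogn : Real.log ((n : ℝ) + 1) ≤ (7 + 2 * netDepth hs * b) * Real.log m := by
    calc Real.log ((n : ℝ) + 1) ≤ Real.log (3 * b ^ netDepth hs * m) :=
          Real.log_le_log (by positivity) hn1
      _ = Real.log 3 + netDepth hs * Real.log b + Real.log m := by
          rw [Real.log_mul (by positivity) (by positivity),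
            Real.log_mul (by positivity) (by positivity), Real.log_pow]
      -- The factor exponential in the depth has become k log b, and log b ≤ b makes it polynomial.
      _ ≤ 3 + netDepth hs * b + Real.log m := by
          gcongr
          · exact Real.log_le_self (by norm_num)
          · exact Real.log_le_self (by linarith)
      -- With 1 ≤ 2 log m, the terms 3 and kb become 6 log m and 2kb log m; hence 7 + 2kb.
      _ ≤ _ := by
          have : (0 : ℝ) ≤ netDepth hs * b := by positivity
          nlinarith
  rw [Fintype.card_fun, Fintype.card_fin]
  push_cast
  rw [Real.log_pow, mul_assoc _ _ (Real.log m)]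
  have : 0 ≤ Real.log ((n : ℝ) + 1) := Real.log_nonneg (by simp)
  gcongr

/-- Expected excess risk of the empirical risk minimizer, with explicit constants. -/
theorem BackwardStep.Bounded.integral_excess_risk_le {d : ℕ} {T κ ρ v R C c I : ℝ} {hs : List ℕ}
    {S : BackwardStep d} {M : ForwardModel} (hB : S.Bounded T κ ρ v hs) (hR : 0 ≤ R) (hRρ : R ≤ ρ)
    (hv2 : (1 : ℝ) + 1 ≤ v)
    (hE : ∀ w : NoiseSpace d, stateSize M S.t S.h w ≤ C * noiseEnvelope c w)
    (hI : Integrable (fun w : NoiseSpace d => noiseEnvelope c w ^ 8) (gaussianNoise d))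
    (hI8 : ∫ w : NoiseSpace d, noiseEnvelope c w ^ 8 ∂gaussianNoise d ≤ I)
    {θstar : PairParam d hs} (hstar : θstar ∈ paramSpace d hs R) {m : ℕ} (hm : 2 ≤ m)
    {Ω : Type*} [MeasurableSpace Ω] {P : Measure Ω} [IsProbabilityMeasure P]
    {w : Fin m → Ω → NoiseSpace d} (hw : ∀ j, HasLaw (w j) (gaussianNoise d) P)
    (hind : iIndepFun w P) {θm : Ω → PairParam d hs}
    (hmin : ∀ᵐ ω ∂P, IsArgMin (empiricalRisk M S fun j => w j ω) (paramSpace d hs R) (θm ω))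
    (hint : Integrable (fun ω => risk M S (θm ω) - risk M S θstar) P) {K : ℝ}
    (hK : (3 + T) ^ 2 * C ^ 2 * (κ * ρ * v ^ 2) = K) :
    ∫ ω, (risk M S (θm ω) - risk M S θstar) ∂P ≤
      (2 * netDepth hs * v ^ 2 * (7 + 2 * netDepth hs * (2 * ρ * v)) + K ^ 4 * I +
        16 * ρ * K ^ 2 * I) * (1 / √m) * Real.log m := by
  classical
  have hρ1 := hB.one_le_ρ
  have hsub : paramSpace d hs R ⊆ paramSpace d hs ρ := fun θ (hθ : ‖θ‖ ≤ R) => hθ.trans hRρ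
  have hI0 : 0 ≤ I := le_trans (integral_nonneg fun w => by positivity) hI8
  have hm2 : (2 : ℝ) ≤ m := by exact_mod_cast hm
  have hsm : 0 < √(m : ℝ) := Real.sqrt_pos.2 (by linarith)
  have hlog := half_le_log hm
  obtain ⟨b, hb⟩ : ∃ b, b = 2 * ρ * v := ⟨_, rfl⟩
  have hb1 : 1 ≤ b := by nlinarith
  obtain ⟨k, hk⟩ : ∃ k, k = netDepth hs := ⟨_, rfl⟩
  have hbk : 0 < b ^ k := by positivity
  -- With this n, the mesh 2R/n times the Lipschitz factor b ^ k is at most 2R/√m.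
  obtain ⟨n, hn⟩ : ∃ n, n = ⌈b ^ k * √m⌉₊ := ⟨_, rfl⟩
  have hn0 : 0 < n := hn ▸ Nat.ceil_pos.2 (by positivity)
  have hnle : b ^ k * √m ≤ n := hn ▸ Nat.le_ceil _
  have hnR : (0 : ℝ) < n := by exact_mod_cast hn0
  have herm := _root_.integral_excess_risk_le (ν := gaussianNoise d) (P := P)
    (ℓ := fun x θ => sampleLoss M S x θ) (A := paramSpace d hs R)
    (fun θ _ => hB.measurable_sampleLoss M θ)
    (fun x θ => by rw [sampleLoss_eq_sq]; positivity)
    (fun θ hθ => hB.integrable_sq_sampleLoss hE hI (hsub hθ))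
    (V := K ^ 4 * I)
    (fun θ hθ => (hB.integral_sq_sampleLoss_le hE hI (hsub hθ)).trans
      (by rw [hK]; gcongr))
    (Λ := fun x => 2 * R / n * (2 * b ^ k * K ^ 2 * noiseEnvelope c x ^ 8))
    ((hI.const_mul _).const_mul _) (pt := paramGrid R n) (fun j => paramGrid_mem hR j)
    (fun θ hθ => by
      obtain ⟨j, hj⟩ := exists_paramGrid_near hR hn0.ne' hθ
      refine ⟨j, fun x => (hB.abs_sampleLoss_sub_le_envelope hE (hsub hθ)
        (hsub (paramGrid_mem hR j)) x).trans ?_⟩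
      rw [hK, ← hb, hk]
      have := one_le_noiseEnvelope c x
      exact mul_le_mul_of_nonneg_right hj (by positivity))
    hstar (by omega) hw hind hmin hint
  refine herm.trans ?_
  have hcard := log_card_grid_le (d := d) (hs := hs) hb1 hB.input_le hB.hidden_le hv2 hm (n := n)
    (by rw [hn, ← hk]; exact (Nat.ceil_lt_add_one (by positivity)).le)
  rw [← hk] at hcard
  rw [integral_const_mul, integral_const_mul, ← hb, ← hk]
  have hmesh : 2 * (2 * R / n * (2 * b ^ k * K ^ 2 *
      ∫ w : NoiseSpace d, noiseEnvelope c w ^ 8 ∂gaussianNoise d)) ≤ 8 * ρ * K ^ 2 * I / √m := by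
    calc 2 * (2 * R / n * (2 * b ^ k * K ^ 2 *
          ∫ w : NoiseSpace d, noiseEnvelope c w ^ 8 ∂gaussianNoise d))
        ≤ 2 * (2 * ρ / (b ^ k * √m) * (2 * b ^ k * K ^ 2 * I)) := by gcongr
      _ = 8 * ρ * K ^ 2 * I / √m := by field_simp; ring
  calc _ ≤ (2 * k * v ^ 2 * (7 + 2 * k * b) * Real.log m + K ^ 4 * I / 2) / √m +
        8 * ρ * K ^ 2 * I / √m := by gcongr
    _ = (2 * k * v ^ 2 * (7 + 2 * k * b) * Real.log m + K ^ 4 * I * (1 / 2) +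
        16 * ρ * K ^ 2 * I * (1 / 2)) * (1 / √m) := by ring
    -- Each factor 1/2 has been split off to be replaced by log m.
    _ ≤ (2 * k * v ^ 2 * (7 + 2 * k * b) * Real.log m + K ^ 4 * I * Real.log m +
        16 * ρ * K ^ 2 * I * Real.log m) * (1 / √m) := by gcongr
    _ = _ := by ring

theorem theorem4p1 (M : ForwardModel) (hab : M.a ≤ M.b) (T : ℝ) (hT : 0 < T) :
    ∃ p : MvPolynomial (Fin 4) ℝ,
      ∀ (d : ℕ) (hs : List ℕ) (R : ℝ), 0 ≤ R →
      ∀ (f : ℝ → EuclideanSpace ℝ (Fin d) → ℝ → EuclideanSpace ℝ (Fin d) → ℝ)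
        (g : EuclideanSpace ℝ (Fin d) → ℝ) (Cf Cg : ℝ), 0 ≤ Cf → 0 ≤ Cg →
        LipschitzNonlinearity T Cf f → LipschitzTerminal Cg g →
      ∀ (N : ℕ) (t : Fin (N + 1) → ℝ), StrictMono t → t 0 = 0 → t (Fin.last N) = T →
      ∀ (i : Fin N) (Uhat : EuclideanSpace ℝ (Fin d) → ℝ),
        (i.succ = Fin.last N → Uhat = g) →
        (i.succ ≠ Fin.last N → ∃ ϑ : NetIdx d hs 1 → ℝ, ‖ϑ‖ ≤ R ∧ Uhat = scalarNet ϑ) →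
      ∀ S : BackwardStep d,
        S = { f := f, t := t i.castSucc, h := t i.succ - t i.castSucc, Uhat := Uhat } →
      ∀ θstar : PairParam d hs, IsArgMin (risk M S) (paramSpace d hs R) θstar →
      ∀ (m : ℕ), 2 ≤ m →
      ∀ {Ω : Type*} [MeasurableSpace Ω] (P : Measure Ω) [IsProbabilityMeasure P]
        (w : Fin m → Ω → NoiseSpace d), (∀ j, HasLaw (w j) (gaussianNoise d) P) → iIndepFun w P →
      ∀ θm : Ω → PairParam d hs, AEMeasurable θm P →
        (∀ᵐ ω ∂P, IsArgMin (empiricalRisk M S fun j => w j ω) (paramSpace d hs R) (θm ω)) →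
      (∀ θ ∈ paramSpace d hs R, Integrable (fun x => sampleLoss M S x θ) (gaussianNoise d)) ∧
      Integrable (fun ω => risk M S (θm ω) - risk M S θstar) P ∧
      ∫ ω, (risk M S (θm ω) - risk M S θstar) ∂P ≤
        MvPolynomial.eval ![R, (netWidth d hs 1 : ℝ), (netDepth hs : ℝ), constFG Cf Cg f g] p
          * (m : ℝ) ^ (-(1 / 2) : ℝ) * Real.log m := by
  -- These constants are fixed before the dimension and the other data, so they may serve as
  -- coefficients of p.
  obtain ⟨C, c, hC, hstate⟩ := exists_norm_state_le M hT.le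
  obtain ⟨C₈, hC₈, hmoment⟩ := exists_integral_noiseEnvelope_le c
  -- Polynomial counterparts of the bounds in `bounded_backwardStep`; evaluation gives 1 + R, 1 +
  -- width, depth and 1 + `constFG`.
  let ρ : MvPolynomial (Fin 4) ℝ := 1 + MvPolynomial.X 0
  let v : MvPolynomial (Fin 4) ℝ := 1 + MvPolynomial.X 1
  let k : MvPolynomial (Fin 4) ℝ := MvPolynomial.X 2
  let κ : MvPolynomial (Fin 4) ℝ := 1 + MvPolynomial.X 3
  let K : MvPolynomial (Fin 4) ℝ := MvPolynomial.C ((3 + T) ^ 2 * C ^ 2) * (κ * ρ * v ^ 2)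
  let I : MvPolynomial (Fin 4) ℝ := MvPolynomial.C C₈ * v ^ 8
  refine ⟨2 * k * v ^ 2 * (7 + 2 * k * (2 * ρ * v)) + K ^ 4 * I + 16 * ρ * K ^ 2 * I, ?_⟩
  intro d hs R hR f g Cf Cg hCf hCg hf hg N t ht ht0 htN i Uhat hUlast hUnet S hS θstar hstar m hm
    Ω _ P _ w hw hind θm hθm hmin
  have htpos : 0 ≤ t i.castSucc := ht0 ▸ ht.monotone (Fin.zero_le _)
  have hstep : 0 ≤ t i.succ - t i.castSucc :=
    sub_nonneg.2 (ht.monotone i.castSucc_lt_succ.le)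
  have hend : t i.castSucc + (t i.succ - t i.castSucc) ≤ T := by
    rw [add_sub_cancel, ← htN]; exact ht.monotone (Fin.le_last _)
  have hB := bounded_backwardStep (hs := hs) hR hf hg htpos hstep hend (Uhat := Uhat)
    ((em (i.succ = Fin.last N)).imp hUlast hUnet)
  rw [← hS] at hB
  have hE : ∀ w : NoiseSpace d, stateSize M S.t S.h w ≤ C * noiseEnvelope c w := fun w =>
    hstate d S.t S.h hB.t_nonneg hB.h_nonneg hB.add_le w
  obtain ⟨hI, hI8⟩ := hmoment d
  have hI8' : ∫ w : NoiseSpace d, noiseEnvelope c w ^ 8 ∂gaussianNoise d ≤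
      C₈ * (1 + (netWidth d hs 1 : ℝ)) ^ 8 :=
    hI8.trans (mul_le_mul_of_nonneg_left (pow_le_pow_left₀ (by positivity) hB.input_le 8) hC₈)
  have hRρ : R ≤ 1 + R := by linarith
  have hsub : paramSpace d hs R ⊆ paramSpace d hs (1 + R) := fun θ (hθ : ‖θ‖ ≤ R) => hθ.trans hRρ
  have hv2 : (1 : ℝ) + 1 ≤ 1 + netWidth d hs 1 := by
    have : (1 : ℝ) ≤ netWidth d hs 1 := by
      exact_mod_cast le_foldr_max (l := d :: 1 :: hs) (h := 1) (by simp)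
    linarith
  have hint := hB.integrable_excess_risk hE hI hθm
    (hmin.mono fun ω hω => hsub hω.1) (hsub hstar.1)
  refine ⟨fun θ hθ => hB.integrable_sampleLoss hE hI (hsub hθ), hint, ?_⟩
  refine (hB.integral_excess_risk_le hR hRρ hv2 hE hI hI8' hstar.1 hm hw hind hmin hint
    rfl).trans_eq ?_
  rw [Real.rpow_neg (by positivity), ← Real.sqrt_eq_rpow, ← one_div]
  congr 2
  simp [k, v, ρ, κ, K, I]
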